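/- **Sparse linear regression by iterative hard thresholding.** Let $\Sigma\in\mathbb R^{p\times p}$ ($p\ge 1$) be positive definite with $\Sigma_{jj}\le 1$ for all $j$, with smallest and largest eigenvalues $\sigma_{\min}(\Sigma),\sigma_{\max}(\Sigma)$ and $\kappa(\Sigma)=\sigma_{\max}(\Sigma)/\sigma_{\min}(\Sigma)$. Let $X_1,\dots,X_n$ be i.i.d. from a centred sub-Gaussian distribution with covariance $\Sigma$ and relative sub-Gaussian parameter $K$, i.e. $\mathbb E e^{t\langle u,X_i\rangle}\le e^{K^2 (u^\top\Sigma u) t^2/2}$ for all $u\in\mathbb R^p$, $t\in\mathbb R$. Let $Y_i=\langle\bar\theta,X_i\rangle+\xi_i$ with $\|\bar\theta\|_0\le s^*$ and $\xi_i$ i.i.d. $N(0,\sigma^2)$, independent of $X_1,\dots,X_n$. Put $f(\theta)=\frac1n\|Y-X\theta\|_2^2$, $s=\lceil 2592\,\kappa(\Sigma)^2 s^*\rceil$, $k=2s+s^*$. A differentiable function $f$ satisfies RSC (resp. RSS) at sparsity level $k$ with parameter $\alpha$ (resp. $L$) if $f(\theta_1)-f(\theta_2)-\langle\theta_1-\theta_2,\nabla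 f(\theta_2)\rangle$ is at least $\frac\alpha2\|\theta_1-\theta_2\|_2^2$ (resp. at most $\frac L2\|\theta_1-\theta_2\|_2^2$) whenever $\|\theta_1\|_0\le s_1$, $\|\theta_2\|_0\le s_2$, $s_1+s_2=k$. IHT with step size $\eta$ is the iteration $\theta^0=0$, $\theta^{t+1}=P_s(\theta^t-\eta\nabla f(\theta^t))$, where $P_s$ keeps $s$ entries of largest magnitude (ties broken arbitrarily; all entries if $s\ge p$) and sets the others to zero. There are universal constants $C,c_2,c_3>0$ and constants $c_0,c_1>0$ depending only on $K$ such that, if $n>c_1\,k\log p/\sigma_{\min}(\Sigma)$, then with probability at least $1-e^{-c_0n}-c_2p^{-c_3}$ all of the following hold: 1. $f$ satisfies RSC at level $k$ with parameter $\frac14\sigma_{\min}(\Sigma)$ and RSS at level $k$ with parameter $\frac94\sigma_{\max}(\Sigma)$. 2. Let $\alpha\ge\frac14\sigma_{\min}(\Sigma)$ be any RSC parameter and $0<L\le\frac94\sigma_{\max}(\Sigma)$ any RSS parameter of $f$ at level $k$, let $(\theta^t)$ be any run of IHT with step size $\eta=\frac{2}{3L}$, and let $\theta^*$ be any minimizer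 of $f$ over $\{\theta:\|\theta\|_0\le s^*\}$. Then: - for every $\epsilon>0$ and every $\tau\ge C\,\frac{L}{\alpha}\log\frac{f(\theta^0)}{\epsilon}$ (an integer $\tau\ge0$), $f(\theta^\tau)-f(\theta^*)\le\epsilon$; - for every $\tau\ge0$ and every $\epsilon\ge0$ with $f(\theta^\tau)-f(\theta^*)\le\epsilon$, $$\|\bar\theta-\theta^\tau\|_2\le 145\,\frac{\kappa(\Sigma)}{\sigma_{\min}(\Sigma)}\,\sigma\sqrt{\frac{s^*\log p}{n}}+2\sqrt{\frac{\epsilon}{\sigma_{\min}(\Sigma)}}.$$ -/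

import Mathlib

open MeasureTheory ProbabilityTheory
open scoped NNReal ENNReal

noncomputable section

namespace SparseRegression

/-- Parameter space `ℝ^p` with the Euclidean norm and inner product. -/
abbrev Vec (p : ℕ) := EuclideanSpace ℝ (Fin p)

/-- `‖θ‖₀`: the number of nonzero coordinates. -/
def l0norm {p : ℕ} (θ : Vec p) : ℕ := hammingNorm (fun i => θ i)

/-- Restricted strong convexity at sparsity level `k` with parameter `α`
(required for every way of writing `k = s₁ + s₂`). -/
def RSC {p : ℕ} (f : Vec p → ℝ) (k : ℕ) (α : ℝ) : Prop :=
  Differentiable ℝ f ∧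
    ∀ s₁ s₂ : ℕ, s₁ + s₂ = k → ∀ θ₁ θ₂ : Vec p, l0norm θ₁ ≤ s₁ → l0norm θ₂ ≤ s₂ →
      inner ℝ (θ₁ - θ₂) (gradient f θ₂) + α / 2 * ‖θ₁ - θ₂‖ ^ 2 ≤ f θ₁ - f θ₂

/-- Restricted strong smoothness at sparsity level `k` with parameter `L`. -/
def RSS {p : ℕ} (f : Vec p → ℝ) (k : ℕ) (L : ℝ) : Prop :=
  Differentiable ℝ f ∧
    ∀ s₁ s₂ : ℕ, s₁ + s₂ = k → ∀ θ₁ θ₂ : Vec p, l0norm θ₁ ≤ s₁ → l0norm θ₂ ≤ s₂ →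
      f θ₁ - f θ₂ ≤ inner ℝ (θ₁ - θ₂) (gradient f θ₂) + L / 2 * ‖θ₁ - θ₂‖ ^ 2

/-- `w = P_s(z)`: `w` keeps the coordinates of `z` on a set of `s` coordinates of largest
magnitude (all coordinates if `s ≥ p`) and is zero elsewhere. Ties may be broken arbitrarily. -/
def IsHardThreshold {p : ℕ} (s : ℕ) (z w : Vec p) : Prop :=
  ∃ S : Finset (Fin p), S.card = min s p ∧
    (∀ i ∈ S, ∀ j ∉ S, |z j| ≤ |z i|) ∧
    ∀ i, w i = if i ∈ S then z i else 0

/-- `θ 0, θ 1, θ 2, …` are iterates of iterative hard thresholding for `f` with sparsity level `s`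
and step size `η`, started at zero. -/
def IsIHT {p : ℕ} (f : Vec p → ℝ) (s : ℕ) (η : ℝ) (θ : ℕ → Vec p) : Prop :=
  θ 0 = 0 ∧ ∀ t, IsHardThreshold s (θ t - η • gradient f (θ t)) (θ (t + 1))

/-- `θ` minimizes `f` over the `k`-sparse vectors. -/
def IsSparseMinimizer {p : ℕ} (f : Vec p → ℝ) (k : ℕ) (θ : Vec p) : Prop :=
  l0norm θ ≤ k ∧ ∀ θ' : Vec p, l0norm θ' ≤ k → f θ ≤ f θ'

/-- Least squares loss `(1/n) ‖y - x θ‖₂²` with design rows `x i` and responses `y i`. -/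
def lsLoss {n p : ℕ} (x : Fin n → Vec p) (y : Fin n → ℝ) (θ : Vec p) : ℝ :=
  1 / (n : ℝ) * ∑ i, (y i - inner ℝ (x i) θ) ^ 2

/-- Smallest eigenvalue (for a covariance matrix: smallest singular value). -/
def sigmaMin {p : ℕ} {S : Matrix (Fin p) (Fin p) ℝ} (hS : S.IsHermitian) : ℝ :=
  ⨅ i, hS.eigenvalues i

/-- Largest eigenvalue (for a covariance matrix: largest singular value). -/
def sigmaMax {p : ℕ} {S : Matrix (Fin p) (Fin p) ℝ} (hS : S.IsHermitian) : ℝ :=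
  ⨆ i, hS.eigenvalues i

/-- Condition number. -/
def kappa {p : ℕ} {S : Matrix (Fin p) (Fin p) ℝ} (hS : S.IsHermitian) : ℝ :=
  sigmaMax hS / sigmaMin hS

/-- `P` is a centred sub-Gaussian distribution on `ℝ^p` with covariance `S`: every one-dimensional
marginal `⟨u, x⟩` satisfies `E exp(t ⟨u, x⟩) ≤ exp(K² (uᵀ S u) t² / 2)` for all real `t`.
`K` is the sub-Gaussian parameter relative to the covariance (`K = 1` for `N(0, S)`). -/
structure IsSubgaussianDesign {p : ℕ} (K : ℝ≥0) (S : Matrix (Fin p) (Fin p) ℝ)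
    (P : Measure (Vec p)) : Prop where
  isProbabilityMeasure : IsProbabilityMeasure P
  mean_eq : ∀ j, ∫ x, x j ∂P = 0
  cov_eq : ∀ j l, cov[fun x : Vec p => x j, fun x : Vec p => x l; P] = S j l
  subgaussian : ∀ u : Vec p,
    HasSubgaussianMGF (fun x : Vec p => inner ℝ u x)
      (K ^ 2 * (dotProduct (fun i => u i) (S.mulVec (fun i => u i))).toNNReal) P

/-- The sparse linear regression model `Y_i = ⟨θbar, X_i⟩ + ξ_i`: the rows `X_i` are i.i.d. from
`P`, the label noises `ξ_i` are i.i.d. `N(0, σ²)`, and the noise is independent of the design. -/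
structure IsRegressionModel {Ω : Type*} [MeasurableSpace Ω] {n p : ℕ} (μ : Measure Ω)
    (P : Measure (Vec p)) (σ : ℝ≥0) (θbar : Vec p)
    (X : Fin n → Ω → Vec p) (ξ Y : Fin n → Ω → ℝ) : Prop where
  design_law : ∀ i, HasLaw (X i) P μ
  design_indep : iIndepFun X μ
  noise_law : ∀ i, HasLaw (ξ i) (gaussianReal 0 (σ ^ 2)) μ
  noise_indep : iIndepFun ξ μ
  design_noise_indep : IndepFun (fun ω i => X i ω) (fun ω i => ξ i ω) μ
  response_eq : ∀ i ω, Y i ω = inner ℝ θbar (X i ω) + ξ i ω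

end SparseRegression

end

/-!
The proof separates a deterministic part from two random events.

**Optimization.** Let `J` be the set kept by one step of iterative hard thresholding, `g` the
gradient at `θ`, and `θs` an `r`-sparse competitor. Restricted smoothness bounds the decrease of the
loss by a completed square, and the new indices in `J` are paid for by old indices that were
discarded in exchange. What remains off `J` has at most `r` indices, so it carries at most the
fraction `r / s` of the mass that an `r`-sparse competitor must miss (`IsHardThreshold.step`).
Together with restricted convexity and `s ≥ 32 (L / α)² r` this contracts the excess loss by
`1 - α / (4 L)` in every step, whether or not the excess is positive (`iht_step_le`). The factor
`2592 = 32 * 9²` covers every admissible pair, because `L / α ≤ 9 κ`.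

**Design event.** Squares of sub-Gaussian variables are sub-exponential (`integral_exp_mul_sq_le`),
so the empirical second moment in a fixed direction concentrates around the quadratic form of `S`.
In coordinates in which that form is the Euclidean norm, a `1/4`-net of each coordinate subspace
with at most `25 ^ k` points makes this uniform over all `k`-sparse directions, with relative error
`1/1000` (`measure_exists_sparse_dev_le`). As the loss is quadratic, restricted convexity and
smoothness follow.

**Noise event.** Given the design, the correlation of the noise with a column is Gaussian, and a
union bound over the columns controls all of them (`measure_exists_noise_corr_gt_le`). The basic
inequality for least squares then bounds the estimation error (`estimation_error_le`). The constant
`145` leaves little room: the bound has the form `2 √(2594 a) / (1 - δ)` with relative error `δ` and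
Gaussian level `a`, where the union bound needs `a > 2 (1 + δ)`. The choice `δ = 1/1000`,
`a = 101/50` meets both requirements.
-/

namespace SparseRegression

/-! ### Sparsity -/

/-- The set of nonzero coordinates of `θ`. -/
noncomputable def supp {p : ℕ} (θ : Vec p) : Finset (Fin p) := {i | θ i ≠ 0}

lemma mem_supp {p : ℕ} {θ : Vec p} {i : Fin p} : i ∈ supp θ ↔ θ i ≠ 0 := by simp [supp]

lemma card_supp {p : ℕ} (θ : Vec p) : (supp θ).card = l0norm θ := by
  simp [supp, l0norm, hammingNorm]

lemma l0norm_le_card {p : ℕ} {θ : Vec p} {T : Finset (Fin p)} (h : ∀ i, θ i ≠ 0 → i ∈ T) :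
    l0norm θ ≤ T.card := by
  rw [← card_supp]
  exact Finset.card_le_card fun i hi => h i (mem_supp.1 hi)

lemma l0norm_le_dim {p : ℕ} (θ : Vec p) : l0norm θ ≤ p := by
  simpa using l0norm_le_card (θ := θ) (T := Finset.univ) (by simp)

@[simp] lemma l0norm_zero {p : ℕ} : l0norm (0 : Vec p) = 0 := by simp [l0norm, hammingNorm]

lemma eq_zero_of_l0norm {p : ℕ} {θ : Vec p} (h : l0norm θ ≤ 0) : θ = 0 := by
  have h0 : supp θ = ∅ := by rw [← Finset.card_eq_zero, card_supp]; omega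
  ext i
  by_contra hi
  have := mem_supp.2 hi
  simp [h0] at this

lemma l0norm_sub_le {p : ℕ} (θ₁ θ₂ : Vec p) : l0norm (θ₁ - θ₂) ≤ l0norm θ₁ + l0norm θ₂ := by
  classical
  rw [← card_supp θ₁, ← card_supp θ₂]
  refine (l0norm_le_card (T := supp θ₁ ∪ supp θ₂) fun i hi => ?_).trans (Finset.card_union_le _ _)
  by_contra h
  simp only [Finset.mem_union, mem_supp, not_or, not_not] at h
  exact hi (by simp [h.1, h.2])

lemma l0norm_single_le {p : ℕ} (j : Fin p) (c : ℝ) :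
    l0norm (EuclideanSpace.single j c) ≤ 1 := by
  refine (l0norm_le_card (T := {j}) fun i hi => ?_).trans (by simp)
  by_contra h
  exact hi (by simp at h; simp [h])

lemma IsHardThreshold.l0norm_le {p s : ℕ} {z w : Vec p} (h : IsHardThreshold s z w) :
    l0norm w ≤ s := by
  obtain ⟨S, hS, -, hw⟩ := h
  refine (l0norm_le_card (T := S) fun i hi => ?_).trans (hS.le.trans (min_le_left _ _))
  by_contra hiS
  exact hi (by rw [hw, if_neg hiS])

/-- The `ℓ¹`-norm of a `k`-sparse vector is at most `√k` times its Euclidean norm. -/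
lemma sum_abs_le_sqrt_mul_norm {p : ℕ} (v : Vec p) :
    ∑ j, |v j| ≤ √(l0norm v) * ‖v‖ := by
  have h1 : ∑ j, |v j| = ∑ j ∈ supp v, |v j| := by
    symm
    apply Finset.sum_subset (Finset.subset_univ _)
    intro j _ hj
    simpa [mem_supp] using hj
  have h2 : (∑ j ∈ supp v, |v j|) ^ 2 ≤ (l0norm v : ℝ) * ‖v‖ ^ 2 := by
    rw [← card_supp, EuclideanSpace.real_norm_sq_eq]
    refine (sq_sum_le_card_mul_sum_sq).trans ?_
    refine mul_le_mul_of_nonneg_left ?_ (by positivity)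
    simp only [sq_abs]
    exact Finset.sum_le_univ_sum_of_nonneg fun _ => sq_nonneg _
  rw [h1]
  refine Real.le_sqrt_of_sq_le h2 |>.trans ?_
  rw [Real.sqrt_mul (by positivity), Real.sqrt_sq (norm_nonneg _)]

/-! ### Hard thresholding -/

/-- If the values on `J` dominate the values off `J`, some threshold separates them. -/
lemma exists_threshold {ι : Type*} [Fintype ι] (J : Finset ι) (hJ : J.Nonempty) (a : ι → ℝ)
    (hle : ∀ i ∈ J, ∀ j ∉ J, a j ≤ a i) :
    ∃ c, (∀ i ∈ J, c ≤ a i) ∧ ∀ j ∉ J, a j ≤ c := by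
  obtain ⟨i, hi, hmin⟩ := J.exists_min_image a hJ
  exact ⟨a i, hmin, fun j hj => hle i hi j hj⟩

/-- If `J` carries the largest values of `a` then a set `R` disjoint from `J` has a smaller sum
than any subset of `J` with at least as many elements. -/
lemma sum_le_sum_of_dominated {ι : Type*} [Fintype ι] {J R R' : Finset ι}
    {a : ι → ℝ} (ha : ∀ i, 0 ≤ a i) (hle : ∀ i ∈ J, ∀ j ∉ J, a j ≤ a i)
    (hR : ∀ i ∈ R, i ∉ J) (hR' : R' ⊆ J) (hcard : R.card ≤ R'.card) :
    ∑ i ∈ R, a i ≤ ∑ i ∈ R', a i := by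
  rcases R.eq_empty_or_nonempty with rfl | hne
  · simpa using Finset.sum_nonneg fun i _ => ha i
  have hne' : R'.Nonempty := by
    rw [← Finset.card_pos] at hne ⊢
    omega
  obtain ⟨c, h1, h2⟩ := exists_threshold J (hne'.mono hR') a hle
  obtain ⟨i, hi⟩ := hne
  have hc : 0 ≤ c := (ha i).trans (h2 i (hR i hi))
  calc ∑ i ∈ R, a i ≤ R.card * c := by
        simpa using Finset.sum_le_card_nsmul R a c fun i hi => h2 i (hR i hi)
    _ ≤ R'.card * c := by gcongr
    _ ≤ ∑ i ∈ R', a i := by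
        simpa using Finset.card_nsmul_le_sum R' a c fun i hi => h1 i (hR' hi)

/-- Relative optimality of hard thresholding: if `J` carries the largest values and `Q` is a set of
at most `r ≤ |J|` further indices, then the mass on `Q` is at most the fraction `r / |J|` of the
mass left on `J ∪ Q` after removing any set of at most `r` indices. -/
lemma card_mul_sum_le_of_dominated {ι : Type*} [Fintype ι] [DecidableEq ι] {J Q T : Finset ι}
    {a : ι → ℝ} (ha : ∀ i, 0 ≤ a i) (hle : ∀ i ∈ J, ∀ j ∉ J, a j ≤ a i)
    (hQJ : ∀ i ∈ Q, i ∉ J) {r : ℕ} (hQ : Q.card ≤ r) (hT : T.card ≤ r) (hr : r ≤ J.card) :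
    (J.card : ℝ) * ∑ i ∈ Q, a i ≤ r * ∑ i ∈ (J ∪ Q) \ T, a i := by
  rcases J.eq_empty_or_nonempty with rfl | hJ
  · simpa using mul_nonneg (Nat.cast_nonneg r) (Finset.sum_nonneg fun i _ => ha i)
  rcases Q.eq_empty_or_nonempty with rfl | hQne
  · simpa using mul_nonneg (Nat.cast_nonneg r) (Finset.sum_nonneg fun i _ => ha i)
  obtain ⟨c, h1, h2⟩ := exists_threshold J hJ a hle
  have hc : 0 ≤ c := by
    obtain ⟨i, hi⟩ := hQne
    exact (ha i).trans (h2 i (hQJ i hi))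
  have hsplit : ∑ i ∈ (J ∪ Q) \ T, a i = ∑ i ∈ J \ T, a i + ∑ i ∈ Q \ T, a i := by
    rw [Finset.union_sdiff_distrib, Finset.sum_union]
    rw [Finset.disjoint_left]
    intro i hi hi'
    exact hQJ i (Finset.mem_sdiff.1 hi').1 (Finset.mem_sdiff.1 hi).1
  have hQsplit : ∑ i ∈ Q, a i = ∑ i ∈ Q \ T, a i + ∑ i ∈ Q ∩ T, a i := by
    rw [add_comm, Finset.sum_inter_add_sum_sdiff]
  set A := ∑ i ∈ Q \ T, a i
  have e1 : ∑ i ∈ Q ∩ T, a i ≤ (Q ∩ T).card * c := by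
    simpa using Finset.sum_le_card_nsmul (Q ∩ T) a c
      fun i hi => h2 i (hQJ i (Finset.mem_inter.1 hi).1)
  have e2 : A ≤ (Q \ T).card * c := by
    simpa using Finset.sum_le_card_nsmul (Q \ T) a c
      fun i hi => h2 i (hQJ i (Finset.mem_sdiff.1 hi).1)
  have e3 : ((J \ T).card : ℝ) * c ≤ ∑ i ∈ J \ T, a i := by
    simpa using Finset.card_nsmul_le_sum (J \ T) a c fun i hi => h1 i (Finset.mem_sdiff.1 hi).1
  have c1 : ((Q ∩ T).card : ℝ) + (Q \ T).card ≤ r := by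
    have := Finset.card_inter_add_card_sdiff Q T
    exact_mod_cast this.le.trans hQ
  -- `J` and `Q ∩ T` are disjoint, so `T` meets `J` in at most `r - |Q ∩ T|` indices
  have c2 : (J.card : ℝ) + (Q ∩ T).card ≤ (J \ T).card + r := by
    have h3 := Finset.card_inter_add_card_sdiff J T
    have h4 : (J ∩ T).card + (Q ∩ T).card ≤ T.card := by
      rw [← Finset.card_union_of_disjoint]
      · exact Finset.card_le_card (Finset.union_subset Finset.inter_subset_right
          Finset.inter_subset_right)
      · rw [Finset.disjoint_left]
        intro i hi hi'
        exact hQJ i (Finset.mem_inter.1 hi').1 (Finset.mem_inter.1 hi).1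
    exact_mod_cast (by omega : J.card + (Q ∩ T).card ≤ (J \ T).card + r)
  have hr' : (r : ℝ) ≤ J.card := by exact_mod_cast hr
  rw [hsplit, hQsplit]
  generalize ((Q ∩ T).card : ℝ) = x at *
  generalize ((Q \ T).card : ℝ) = d at *
  generalize (J.card : ℝ) = m at *
  generalize ((J \ T).card : ℝ) = l at *
  have hr0 : (0 : ℝ) ≤ r := Nat.cast_nonneg r
  have k1 : A ≤ (r - x) * c := e2.trans (by gcongr; linarith)
  have k2 : (m + x - r) * c ≤ ∑ i ∈ J \ T, a i := le_trans (by gcongr; linarith) e3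
  have k3 : (r : ℝ) * ((m + x - r) * c) ≤ r * ∑ i ∈ J \ T, a i := by gcongr
  have k4 : (m - r) * A ≤ (m - r) * ((r - x) * c) :=
    mul_le_mul_of_nonneg_left k1 (by linarith)
  have k5 : m * ∑ i ∈ Q ∩ T, a i ≤ m * (x * c) :=
    mul_le_mul_of_nonneg_left e1 (hr0.trans hr')
  nlinarith

/-- One step of iterative hard thresholding, compared with an `r`-sparse vector `θs`. Here `G₁` is
the squared gradient mass on the old support and the support of `θs`, and `G₂` the mass on the
indices that are new in `w`. -/
lemma IsHardThreshold.step {p s r : ℕ} {η : ℝ} {θ w g θs : Vec p}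
    (h : IsHardThreshold s (θ - η • g) w) (hθ : l0norm θ ≤ s) (hθs : l0norm θs ≤ r)
    (hrs : r ≤ s) :
    ∃ G₁ G₂ : ℝ, 0 ≤ G₁ ∧ 0 ≤ G₂ ∧
      (inner ℝ (θ - θs) g) ^ 2 ≤ G₁ * ‖θ - θs‖ ^ 2 ∧
      η ^ 2 * G₂ ≤ ‖w - θ‖ ^ 2 ∧
      s * (‖w - θ‖ ^ 2 + 2 * η * inner ℝ (w - θ) g + η ^ 2 * G₁) ≤
        r * (2 * ‖θ - θs‖ ^ 2 + 2 * η ^ 2 * (G₁ + G₂)) := by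
  classical
  obtain ⟨J, hJ, hle, hw⟩ := h
  obtain ⟨St, hSt, hStc⟩ : ∃ St, supp θ ⊆ St ∧ St.card = min s p := by
    apply Finset.exists_superset_card_eq
    · rw [card_supp]
      exact le_min hθ (l0norm_le_dim θ)
    · simp
  set T := supp θs with hT
  set z : Fin p → ℝ := fun i => θ i - η * g i with hz
  have hz' : ∀ i, (θ - η • g) i = z i := fun i => by simp [hz]
  simp only [hz'] at hle hw
  have hsq : ∀ i ∈ J, ∀ j ∉ J, z j ^ 2 ≤ z i ^ 2 := fun i hi j hj => sq_le_sq.2 (hle i hi j hj)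
  have hθ0 : ∀ i, i ∉ St → θ i = 0 := fun i hi => by
    by_contra h0
    exact hi (hSt (mem_supp.2 h0))
  have hθs0 : ∀ i, i ∉ T → θs i = 0 := fun i hi => by
    by_contra h0
    exact hi (mem_supp.2 h0)
  set N := J \ (St ∪ T) with hN
  set G₁ := ∑ i ∈ St ∪ T, g i ^ 2 with hG1
  set G₂ := ∑ i ∈ N, g i ^ 2 with hG2
  have hG1n : 0 ≤ G₁ := Finset.sum_nonneg fun _ _ => sq_nonneg _
  have hG2n : 0 ≤ G₂ := Finset.sum_nonneg fun _ _ => sq_nonneg _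
  have hinner : ∀ a b : Vec p, inner ℝ a b = ∑ i, a i * b i := fun a b => by
    simp [PiLp.inner_apply, mul_comm]
  -- the set `R` of discarded old indices that pays for the new indices `N`
  obtain ⟨R, hRsub, hRc⟩ : ∃ R ⊆ St \ J, R.card = N.card := by
    apply Finset.exists_subset_card_eq
    have h1 : N.card ≤ (J \ St).card := Finset.card_le_card (by
      intro i hi; simp only [hN, Finset.mem_sdiff, Finset.mem_union, not_or] at hi ⊢; tauto)
    have h2 := Finset.card_sdiff_add_card_inter J St
    have h3 := Finset.card_sdiff_add_card_inter St J
    rw [Finset.inter_comm] at h3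
    omega
  set I := J ∪ (St ∪ T) with hI
  set Q := (I \ J) \ R with hQ
  have hRIJ : R ⊆ I \ J := by
    intro i hi
    have := hRsub hi
    simp only [hI, Finset.mem_sdiff, Finset.mem_union] at this ⊢
    tauto
  have hIc : I.card = N.card + (St ∪ T).card := by
    rw [hI, hN, ← Finset.card_sdiff_add_card]
  have hQc : Q.card ≤ r := by
    have h1 : Q.card = (I \ J).card - R.card := Finset.card_sdiff_of_subset hRIJ
    have h2 : (I \ J).card = I.card - J.card :=
      Finset.card_sdiff_of_subset Finset.subset_union_left
    have h3 := Finset.card_union_le St T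
    have h4 : T.card ≤ r := by rw [hT, card_supp]; exact hθs
    omega
  have hQJ : ∀ i ∈ Q, i ∉ J := fun i hi => by
    simp only [hQ, Finset.mem_sdiff] at hi
    exact hi.1.2
  have hTc : T.card ≤ r := by rw [hT, card_supp]; exact hθs
  have hRsum : ∑ i ∈ R, z i ^ 2 ≤ η ^ 2 * G₂ := by
    refine (sum_le_sum_of_dominated (J := J) (R' := N) (fun i => sq_nonneg (z i)) hsq
      (fun i hi => (Finset.mem_sdiff.1 (hRsub hi)).2) Finset.sdiff_subset hRc.le).trans ?_
    rw [hG2, Finset.mul_sum]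
    refine Finset.sum_le_sum fun i hi => ?_
    simp only [hN, Finset.mem_sdiff, Finset.mem_union, not_or] at hi
    simp only [hz, hθ0 i hi.2.1]
    exact le_of_eq (by ring)
  have hQsum : (s : ℝ) * ∑ i ∈ Q, z i ^ 2 ≤ r * ∑ i ∈ (J ∪ Q) \ T, z i ^ 2 := by
    rcases le_total s p with hsp | hsp
    · have hJs : J.card = s := by rw [hJ, min_eq_left hsp]
      rw [← hJs]
      exact card_mul_sum_le_of_dominated (fun i => sq_nonneg (z i)) hsq hQJ hQc hTc (by omega)
    · have hJu : J = Finset.univ := by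
        rw [← Finset.card_eq_iff_eq_univ, hJ, min_eq_right hsp, Fintype.card_fin]
      have hQe : Q = ∅ := Finset.eq_empty_of_forall_notMem fun i hi => hQJ i hi (by simp [hJu])
      rw [hQe]
      simpa using mul_nonneg (Nat.cast_nonneg r) (Finset.sum_nonneg fun i _ => sq_nonneg (z i))
  have hIg : ∑ i ∈ I, g i ^ 2 = G₁ + G₂ := by
    rw [hG1, hG2, hN, hI, ← Finset.sum_union Finset.disjoint_sdiff, Finset.union_sdiff_self_eq_union,
      Finset.union_comm]
  have hUsum : ∑ i ∈ (J ∪ Q) \ T, z i ^ 2 ≤ 2 * ‖θ - θs‖ ^ 2 + 2 * η ^ 2 * (G₁ + G₂) := by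
    have hsub : (J ∪ Q) \ T ⊆ I := by
      intro i hi
      simp only [hQ, hI, Finset.mem_sdiff, Finset.mem_union] at hi ⊢
      tauto
    calc ∑ i ∈ (J ∪ Q) \ T, z i ^ 2
        ≤ ∑ i ∈ (J ∪ Q) \ T, (2 * (θ i - θs i) ^ 2 + 2 * η ^ 2 * g i ^ 2) := by
          refine Finset.sum_le_sum fun i hi => ?_
          rw [hθs0 i (Finset.mem_sdiff.1 hi).2]
          simp only [hz]
          nlinarith [sq_nonneg (θ i + η * g i)]
      _ ≤ ∑ i ∈ I, (2 * (θ i - θs i) ^ 2 + 2 * η ^ 2 * g i ^ 2) :=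
          Finset.sum_le_sum_of_subset_of_nonneg hsub fun i _ _ => by positivity
      _ = 2 * ∑ i ∈ I, (θ i - θs i) ^ 2 + 2 * η ^ 2 * (G₁ + G₂) := by
          rw [Finset.sum_add_distrib, ← Finset.mul_sum, ← Finset.mul_sum, hIg]
      _ ≤ _ := by
          rw [EuclideanSpace.real_norm_sq_eq]
          gcongr
          simpa using Finset.sum_le_univ_sum_of_nonneg (s := I)
            fun i => sq_nonneg (θ i - θs i)
  -- completing the square on `I`, outside of which `w - θ` vanishes
  have hkey : ‖w - θ‖ ^ 2 + 2 * η * inner ℝ (w - θ) g =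
      ∑ i ∈ I \ J, z i ^ 2 - η ^ 2 * (G₁ + G₂) := by
    rw [EuclideanSpace.real_norm_sq_eq, hinner, Finset.mul_sum, ← Finset.sum_add_distrib, ← hIg,
      Finset.mul_sum, ← Finset.sum_subset (Finset.subset_univ I)]
    · have h1 : ∑ i ∈ I \ J, z i ^ 2 = ∑ i ∈ I, (w i - z i) ^ 2 := by
        rw [← Finset.sum_sdiff (Finset.subset_union_left : J ⊆ I)]
        rw [show ∑ i ∈ J, (w i - z i) ^ 2 = 0 from
          Finset.sum_eq_zero fun i hi => by rw [hw, if_pos hi]; ring, add_zero]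
        refine Finset.sum_congr rfl fun i hi => ?_
        rw [hw, if_neg (Finset.mem_sdiff.1 hi).2]; ring
      rw [h1, ← Finset.sum_sub_distrib]
      refine Finset.sum_congr rfl fun i _ => ?_
      simp only [hz, PiLp.sub_apply]
      ring
    · intro i _ hi
      simp only [hI, Finset.mem_union, not_or] at hi
      have h1 : w i = 0 := by rw [hw, if_neg hi.1]
      simp [h1, hθ0 i hi.2.1]
  refine ⟨G₁, G₂, hG1n, hG2n, ?_, ?_, ?_⟩
  · rw [hinner, ← Finset.sum_subset (Finset.subset_univ (St ∪ T)), mul_comm]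
    · refine (Finset.sum_mul_sq_le_sq_mul_sq _ _ _).trans ?_
      gcongr
      rw [EuclideanSpace.real_norm_sq_eq]
      exact Finset.sum_le_univ_sum_of_nonneg fun i => sq_nonneg _
    · intro i _ hi
      simp only [Finset.mem_union, not_or] at hi
      simp [hθ0 i hi.1, hθs0 i hi.2]
  · rw [EuclideanSpace.real_norm_sq_eq, hG2, Finset.mul_sum]
    refine le_trans (Finset.sum_le_sum fun i hi => ?_)
      (Finset.sum_le_univ_sum_of_nonneg (s := N) fun i => sq_nonneg _)
    simp only [hN, Finset.mem_sdiff, Finset.mem_union, not_or] at hi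
    simp only [PiLp.sub_apply, hw, if_pos hi.1, hz, hθ0 i hi.2.1]
    exact le_of_eq (by ring)
  · rw [hkey]
    have hsp : ∑ i ∈ I \ J, z i ^ 2 = ∑ i ∈ Q, z i ^ 2 + ∑ i ∈ R, z i ^ 2 :=
      (Finset.sum_sdiff hRIJ).symm
    rw [hsp]
    have h1 : (s : ℝ) * ∑ i ∈ R, z i ^ 2 ≤ s * (η ^ 2 * G₂) := by gcongr
    have h2 : (r : ℝ) * ∑ i ∈ (J ∪ Q) \ T, z i ^ 2 ≤
      r * (2 * ‖θ - θs‖ ^ 2 + 2 * η ^ 2 * (G₁ + G₂)) := by gcongr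
    nlinarith

/-! ### Linear convergence of iterative hard thresholding -/

/-- Under restricted strong convexity and smoothness, a step of iterative hard thresholding
decreases the excess loss by the factor `1 - α / (4 L)`, whatever the sign of the excess loss. -/
lemma iht_step_le {p s r k : ℕ} {f : Vec p → ℝ} {α L : ℝ} {θ w θs : Vec p}
    (hα : 0 < α) (hL : 0 < L) (hαL : α ≤ L) (hk : k = 2 * s + r)
    (hs : 32 * L ^ 2 * r ≤ α ^ 2 * s) (hs0 : 0 < s)
    (hC : RSC f k α) (hS : RSS f k L)
    (h : IsHardThreshold s (θ - (2 / (3 * L)) • gradient f θ) w) (hθ : l0norm θ ≤ s)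
    (hθs : l0norm θs ≤ r) :
    f w - f θs ≤ (1 - α / (4 * L)) * (f θ - f θs) := by
  have hs0' : (0 : ℝ) < s := by exact_mod_cast hs0
  have hr32 : 32 * (r : ℝ) ≤ s := by
    have h1 : α ^ 2 * s ≤ L ^ 2 * s := by gcongr
    have h2 : L ^ 2 * (32 * r) ≤ L ^ 2 * s := by linarith
    exact le_of_mul_le_mul_left h2 (by positivity)
  have hrs : r ≤ s := by
    have : (r : ℝ) ≤ s := by linarith [(Nat.cast_nonneg r : (0 : ℝ) ≤ r)]
    exact_mod_cast this
  obtain ⟨G₁, G₂, hG1, hG2, hY, hN, hX⟩ := h.step hθ hθs hrs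
  have hw := h.l0norm_le
  have hSS := hS.2 s (s + r) (by omega) w θ hw (by omega)
  have hSC := hC.2 r (2 * s) (by omega) θs θ hθs (by omega)
  rw [norm_sub_rev θs θ, ← neg_sub θ θs, inner_neg_left] at hSC
  generalize inner ℝ (θ - θs) (gradient f θ) = Y at *
  generalize inner ℝ (w - θ) (gradient f θ) = X at *
  generalize ‖w - θ‖ ^ 2 = N at *
  have hD : 0 ≤ ‖θ - θs‖ ^ 2 := sq_nonneg _
  generalize ‖θ - θs‖ ^ 2 = D at *
  set η := 2 / (3 * L) with hη
  have hηL : η * L = 2 / 3 := by rw [hη]; field_simp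
  have hη0 : 0 < η := by positivity
  -- Young's inequality for the linear term of restricted strong convexity
  have hYle : Y ≤ G₁ / α + α * D / 4 := by
    refine (Real.le_sqrt_of_sq_le hY).trans ?_
    rw [Real.sqrt_le_left (by positivity)]
    have : G₁ * D = (G₁ / α) * (α * D) := by field_simp
    rw [this]
    nlinarith [sq_nonneg (G₁ / α - α * D / 4)]
  have hgap : f θ - f θs ≤ G₁ / α - α * D / 4 := by linarith
  -- the fraction `a = r / s` of the mass lost by thresholding
  obtain ⟨a, ha⟩ : ∃ a : ℝ, a = r / s := ⟨_, rfl⟩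
  have ha0 : 0 ≤ a := by rw [ha]; positivity
  have ha32 : a ≤ 1 / 32 := by rw [ha, div_le_iff₀ hs0']; linarith
  have haα : 32 * L ^ 2 * a ≤ α ^ 2 := by
    rw [ha, mul_div_assoc', div_le_iff₀ hs0']; linarith
  have hX' : N + 2 * η * X + η ^ 2 * G₁ ≤ a * (2 * D + 2 * η ^ 2 * (G₁ + G₂)) := by
    rw [ha, div_mul_eq_mul_div, le_div_iff₀ hs0']; linarith
  have hdec : f w - f θ ≤ 3 * L / 4 * (N + 2 * η * X) - L / 4 * N := by
    have : 3 * L / 4 * (2 * η * X) = X := by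
      rw [show 3 * L / 4 * (2 * η * X) = (η * L) * (3 / 2) * X by ring, hηL]; ring
    nlinarith
  have h2 : 3 * L / 4 * (N + 2 * η * X) ≤
      3 * L / 4 * (a * (2 * D + 2 * η ^ 2 * (G₁ + G₂)) - η ^ 2 * G₁) := by
    gcongr; linarith
  have h3 : L / 4 * (η ^ 2 * G₂) ≤ L / 4 * N := by gcongr
  have h4 : f w - f θ ≤ 3 * L / 2 * a * D - 3 * L / 4 * η ^ 2 * (1 - 2 * a) * G₁ := by
    have : 0 ≤ L / 4 * (η ^ 2 * G₂) * (1 - 6 * a) := by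
      apply mul_nonneg (by positivity); linarith
    nlinarith
  have h5 : 3 * L / 2 * a * D ≤ α ^ 2 / (16 * L) * D := by
    gcongr
    rw [le_div_iff₀ (by positivity)]
    nlinarith
  have h6 : 1 / (4 * L) * G₁ ≤ 3 * L / 4 * η ^ 2 * (1 - 2 * a) * G₁ := by
    gcongr
    have : 3 * L / 4 * η ^ 2 = 1 / (3 * L) := by rw [hη]; field_simp; norm_num
    rw [this]
    have e : 1 / (4 * L) = 1 / (3 * L) * (3 / 4) := by field_simp
    rw [e]
    gcongr
    linarith
  have h7 : α / (4 * L) * (f θ - f θs) ≤ α / (4 * L) * (G₁ / α - α * D / 4) := by gcongr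
  have h8 : α / (4 * L) * (G₁ / α - α * D / 4) = 1 / (4 * L) * G₁ - α ^ 2 / (16 * L) * D := by
    field_simp; ring
  linarith

lemma IsIHT.l0norm_le {p s : ℕ} {f : Vec p → ℝ} {η : ℝ} {θ : ℕ → Vec p} (h : IsIHT f s η θ)
    (t : ℕ) : l0norm (θ t) ≤ s := by
  cases t with
  | zero => rw [h.1]; simp
  | succ t => exact (h.2 t).l0norm_le

/-- Iterative hard thresholding reaches excess loss `ε` after `4 (L / α) log (f 0 / ε)` steps. -/
lemma IsIHT.converges {p s r k : ℕ} {f : Vec p → ℝ} {α L : ℝ} {θ : ℕ → Vec p} {θs : Vec p}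
    (hα : 0 < α) (hL : 0 < L) (hαL : α ≤ L) (hk : k = 2 * s + r)
    (hs : 32 * L ^ 2 * r ≤ α ^ 2 * s) (hs0 : 0 < s)
    (hC : RSC f k α) (hS : RSS f k L) (hf : ∀ v, 0 ≤ f v)
    (h : IsIHT f s (2 / (3 * L)) θ) (hθs : l0norm θs ≤ r) {ε : ℝ} {τ : ℕ} (hε : 0 < ε)
    (hτ : 4 * (L / α) * Real.log (f (θ 0) / ε) ≤ τ) :
    f (θ τ) - f θs ≤ ε := by
  have hq0 : 0 ≤ 1 - α / (4 * L) := by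
    have : α / (4 * L) ≤ 1 := by rw [div_le_one (by positivity)]; linarith
    linarith
  have hrec : ∀ t, f (θ t) - f θs ≤ (1 - α / (4 * L)) ^ t * (f (θ 0) - f θs) := by
    intro t
    induction t with
    | zero => simp
    | succ t ih =>
      refine (iht_step_le hα hL hαL hk hs hs0 hC hS (h.2 t) (h.l0norm_le t) hθs).trans ?_
      rw [pow_succ', mul_assoc]
      exact mul_le_mul_of_nonneg_left ih hq0
  refine (hrec τ).trans ?_
  have hexp : (1 - α / (4 * L)) ^ τ ≤ Real.exp (-(α / (4 * L) * τ)) := by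
    calc (1 - α / (4 * L)) ^ τ ≤ Real.exp (-(α / (4 * L))) ^ τ := by
          gcongr
          have := Real.add_one_le_exp (-(α / (4 * L)))
          linarith
      _ = _ := by rw [← Real.exp_nat_mul]; congr 1; ring
  have h1 : (1 - α / (4 * L)) ^ τ * (f (θ 0) - f θs) ≤
      Real.exp (-(α / (4 * L) * τ)) * f (θ 0) := by
    refine (mul_le_mul_of_nonneg_left (sub_le_self _ (hf θs)) (pow_nonneg hq0 _)).trans ?_
    exact mul_le_mul_of_nonneg_right hexp (hf _)
  refine h1.trans ?_
  rcases (hf (θ 0)).eq_or_lt with h0 | h0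
  · rw [← h0, mul_zero]; exact hε.le
  have h2 : Real.log (f (θ 0) / ε) ≤ α / (4 * L) * τ := by
    calc Real.log (f (θ 0) / ε) = α / (4 * L) * (4 * (L / α) * Real.log (f (θ 0) / ε)) := by
          field_simp
      _ ≤ _ := by gcongr
  calc Real.exp (-(α / (4 * L) * τ)) * f (θ 0)
      ≤ Real.exp (-Real.log (f (θ 0) / ε)) * f (θ 0) := by gcongr
    _ = ε := by
      rw [Real.exp_neg, Real.exp_log (by positivity)]
      field_simp

/-- At a positive sparsity level, a restricted strong convexity parameter is at most a restricted
strong smoothness parameter. -/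
lemma RSC.le_of_RSS {p k : ℕ} {f : Vec p → ℝ} {α L : ℝ} (hp : 0 < p) (hk : 0 < k)
    (hC : RSC f k α) (hS : RSS f k L) : α ≤ L := by
  have h1 := hC.2 k 0 rfl (EuclideanSpace.single ⟨0, hp⟩ 1) 0
    ((l0norm_single_le _ _).trans hk) (by simp)
  have h2 := hS.2 k 0 rfl (EuclideanSpace.single ⟨0, hp⟩ 1) 0
    ((l0norm_single_le _ _).trans hk) (by simp)
  simp only [sub_zero, PiLp.norm_single, norm_one, one_pow, mul_one] at h1 h2
  linarith

/-! ### The least squares loss -/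

lemma hasGradientAt_lsLoss {n p : ℕ} (x : Fin n → Vec p) (y : Fin n → ℝ) (θ : Vec p) :
    HasGradientAt (lsLoss x y) (-(2 / (n : ℝ)) • ∑ i, (y i - inner ℝ (x i) θ) • x i) θ := by
  rw [hasGradientAt_iff_hasFDerivAt]
  have h : HasFDerivAt (lsLoss x y) ((1 / (n : ℝ)) • ∑ i,
      (2 * (y i - innerSL ℝ (x i) θ)) • (-(innerSL ℝ (x i)))) θ := by
    unfold lsLoss
    refine HasFDerivAt.const_mul (HasFDerivAt.fun_sum fun i _ => ?_) _
    have := ((innerSL ℝ (x i)).hasFDerivAt (x := θ)).const_sub (y i) |>.pow 2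
    simpa using this
  convert! h using 1
  ext v
  simp [Finset.mul_sum]
  refine Finset.sum_congr rfl fun i _ => ?_
  ring

/-- The empirical second moment `(1/n) ‖x v‖²` of the design in direction `v`. -/
noncomputable def empQ {n p : ℕ} (x : Fin n → Vec p) (v : Vec p) : ℝ :=
  1 / (n : ℝ) * ∑ i, (inner ℝ (x i) v) ^ 2

/-- The least squares loss is quadratic with second-order part `empQ`. -/
lemma lsLoss_sub {n p : ℕ} (x : Fin n → Vec p) (y : Fin n → ℝ) (θ₁ θ₂ : Vec p) :
    lsLoss x y θ₁ - lsLoss x y θ₂ =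
      inner ℝ (θ₁ - θ₂) (gradient (lsLoss x y) θ₂) + empQ x (θ₁ - θ₂) := by
  rw [(hasGradientAt_lsLoss x y θ₂).gradient, lsLoss, lsLoss, empQ, inner_smul_right, inner_sum,
    ← mul_sub, ← Finset.sum_sub_distrib]
  simp only [Finset.mul_sum]
  rw [← Finset.sum_add_distrib]
  refine Finset.sum_congr rfl fun i _ => ?_
  rw [inner_smul_right, real_inner_comm (x i) (θ₁ - θ₂), inner_sub_right]
  ring

lemma lsLoss_nonneg {n p : ℕ} (x : Fin n → Vec p) (y : Fin n → ℝ) (θ : Vec p) :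
    0 ≤ lsLoss x y θ :=
  mul_nonneg (by positivity) (Finset.sum_nonneg fun _ _ => sq_nonneg _)

lemma RSC_lsLoss {n p k : ℕ} {x : Fin n → Vec p} {y : Fin n → ℝ} {α : ℝ}
    (h : ∀ v : Vec p, l0norm v ≤ k → α / 2 * ‖v‖ ^ 2 ≤ empQ x v) : RSC (lsLoss x y) k α := by
  refine ⟨fun θ => (hasGradientAt_lsLoss x y θ).differentiableAt, ?_⟩
  intro s₁ s₂ hs θ₁ θ₂ h1 h2
  rw [lsLoss_sub]
  have := h (θ₁ - θ₂) ((l0norm_sub_le _ _).trans (by omega))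
  linarith

lemma RSS_lsLoss {n p k : ℕ} {x : Fin n → Vec p} {y : Fin n → ℝ} {L : ℝ}
    (h : ∀ v : Vec p, l0norm v ≤ k → empQ x v ≤ L / 2 * ‖v‖ ^ 2) : RSS (lsLoss x y) k L := by
  refine ⟨fun θ => (hasGradientAt_lsLoss x y θ).differentiableAt, ?_⟩
  intro s₁ s₂ hs θ₁ θ₂ h1 h2
  rw [lsLoss_sub]
  have := h (θ₁ - θ₂) ((l0norm_sub_le _ _).trans (by omega))
  linarith

/-! ### The quadratic form of the covariance matrix -/

/-- The quadratic form `vᵀ S v`. -/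
def qf {p : ℕ} (S : Matrix (Fin p) (Fin p) ℝ) (v : Vec p) : ℝ :=
  dotProduct (fun i => v i) (S.mulVec (fun i => v i))

lemma qf_eq_sum_eigenvalues {p : ℕ} {S : Matrix (Fin p) (Fin p) ℝ} (hS : S.IsHermitian)
    (v : Vec p) : qf S v = ∑ i, hS.eigenvalues i * (inner ℝ (hS.eigenvectorBasis i) v) ^ 2 := by
  have h1 : qf S v = inner ℝ v (WithLp.toLp 2 (S.mulVec (fun i => v i)) : Vec p) := by
    simp [qf, PiLp.inner_apply, dotProduct, mul_comm]
  rw [h1, ← hS.eigenvectorBasis.sum_inner_mul_inner]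
  refine Finset.sum_congr rfl fun i _ => ?_
  have h2 : inner ℝ (hS.eigenvectorBasis i) (WithLp.toLp 2 (S.mulVec (fun i => v i)) : Vec p) =
      hS.eigenvalues i * inner ℝ (hS.eigenvectorBasis i) v := by
    have h3 := hS.mulVec_eigenvectorBasis i
    have hT : S.transpose = S := by
      rw [← Matrix.conjTranspose_eq_transpose_of_trivial]; exact hS.eq
    calc inner ℝ (hS.eigenvectorBasis i) (WithLp.toLp 2 (S.mulVec (fun i => v i)) : Vec p)
        = dotProduct (⇑(hS.eigenvectorBasis i)) (S.mulVec (fun i => v i)) := by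
          simp [PiLp.inner_apply, dotProduct, mul_comm]
      _ = dotProduct (S.mulVec ⇑(hS.eigenvectorBasis i)) (fun i => v i) := by
          rw [Matrix.dotProduct_mulVec, ← Matrix.mulVec_transpose, hT]
      _ = _ := by
          rw [h3]
          simp [PiLp.inner_apply, dotProduct, Finset.mul_sum, mul_comm, mul_left_comm]
  rw [h2, real_inner_comm v]
  ring

lemma sigmaMin_mul_norm_sq_le_qf {p : ℕ} {S : Matrix (Fin p) (Fin p) ℝ} (hS : S.IsHermitian)
    (v : Vec p) : sigmaMin hS * ‖v‖ ^ 2 ≤ qf S v := by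
  rw [qf_eq_sum_eigenvalues hS, ← hS.eigenvectorBasis.sum_sq_norm_inner_right v, Finset.mul_sum]
  refine Finset.sum_le_sum fun i _ => ?_
  rw [Real.norm_eq_abs, sq_abs]
  gcongr
  exact ciInf_le (Set.finite_range _).bddBelow i

lemma qf_le_sigmaMax_mul_norm_sq {p : ℕ} {S : Matrix (Fin p) (Fin p) ℝ} (hS : S.IsHermitian)
    (v : Vec p) : qf S v ≤ sigmaMax hS * ‖v‖ ^ 2 := by
  rw [qf_eq_sum_eigenvalues hS, ← hS.eigenvectorBasis.sum_sq_norm_inner_right v, Finset.mul_sum]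
  refine Finset.sum_le_sum fun i _ => ?_
  rw [Real.norm_eq_abs, sq_abs]
  gcongr
  exact le_ciSup (Set.finite_range _).bddAbove i

lemma sigmaMin_pos {p : ℕ} {S : Matrix (Fin p) (Fin p) ℝ} (hS : S.PosDef) (hp : 0 < p) :
    0 < sigmaMin hS.isHermitian := by
  have : Nonempty (Fin p) := ⟨⟨0, hp⟩⟩
  obtain ⟨i, hi⟩ := exists_eq_ciInf_of_finite (f := hS.isHermitian.eigenvalues)
  rw [sigmaMin, ← hi]
  exact hS.eigenvalues_pos i

lemma sigmaMin_le_sigmaMax {p : ℕ} {S : Matrix (Fin p) (Fin p) ℝ} (hS : S.IsHermitian)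
    (hp : 0 < p) : sigmaMin hS ≤ sigmaMax hS :=
  (ciInf_le (Set.finite_range _).bddBelow ⟨0, hp⟩).trans
    (le_ciSup (Set.finite_range _).bddAbove _)

lemma one_le_kappa {p : ℕ} {S : Matrix (Fin p) (Fin p) ℝ} (hS : S.PosDef) (hp : 0 < p) :
    1 ≤ kappa hS.isHermitian := by
  rw [kappa, one_le_div (sigmaMin_pos hS hp)]
  exact sigmaMin_le_sigmaMax _ hp

lemma qf_single {p : ℕ} (S : Matrix (Fin p) (Fin p) ℝ) (j : Fin p) :
    qf S (EuclideanSpace.single j 1) = S j j := by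
  have : (fun i => (EuclideanSpace.single j (1 : ℝ) : Vec p) i) = Pi.single j 1 := by
    ext i; simp [Pi.single_apply]
  rw [qf, this]
  simp

lemma qf_nonneg {p : ℕ} {S : Matrix (Fin p) (Fin p) ℝ} (hS : S.PosDef) (v : Vec p) :
    0 ≤ qf S v := by
  rw [qf_eq_sum_eigenvalues hS.isHermitian]
  exact Finset.sum_nonneg fun i _ => mul_nonneg (hS.eigenvalues_pos i).le (sq_nonneg _)

/-- A linear change of coordinates that turns the quadratic form of `S` into the squared Euclidean
norm: coordinates in an eigenbasis, scaled by the square roots of the eigenvalues. -/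
lemma exists_linearEquiv_norm_sq_eq_qf {p : ℕ} {S : Matrix (Fin p) (Fin p) ℝ} (hS : S.PosDef) :
    ∃ e : Vec p ≃ₗ[ℝ] Vec p, ∀ v, ‖e v‖ ^ 2 = qf S v := by
  let lam := hS.isHermitian.eigenvalues
  let b := hS.isHermitian.eigenvectorBasis
  let B : Vec p →ₗ[ℝ] Vec p :=
    { toFun := fun v => WithLp.toLp 2 fun i => √(lam i) * inner ℝ (b i) v
      map_add' := fun v w => by ext i; simp [inner_add_right, mul_add]
      map_smul' := fun c v => by ext i; simp [inner_smul_right]; ring }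
  have hB : ∀ v, ‖B v‖ ^ 2 = qf S v := fun v => by
    rw [qf_eq_sum_eigenvalues hS.isHermitian, EuclideanSpace.real_norm_sq_eq]
    refine Finset.sum_congr rfl fun i _ => ?_
    change (√(lam i) * inner ℝ (b i) v) ^ 2 = _
    rw [mul_pow, Real.sq_sqrt (hS.eigenvalues_pos i).le]
  have hinj : Function.Injective B := by
    rw [← LinearMap.ker_eq_bot, LinearMap.ker_eq_bot']
    intro v hv
    rcases p.eq_zero_or_pos with rfl | hp
    · exact Subsingleton.elim _ _
    have h1 := sigmaMin_mul_norm_sq_le_qf hS.isHermitian v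
    rw [← hB, hv, norm_zero] at h1
    have h2 : ‖v‖ ^ 2 ≤ 0 := by
      have := sigmaMin_pos hS hp
      by_contra h
      push Not at h
      nlinarith [mul_pos this h]
    have h3 : ‖v‖ = 0 := by nlinarith [norm_nonneg v]
    exact norm_eq_zero.1 h3
  exact ⟨LinearEquiv.ofInjectiveEndo B hinj, hB⟩

/-! ### Nets and quadratic forms -/

/-- In dimension `d` the unit ball has a `1/4`-net of at most `25 ^ d` points of norm at most `3/2`:
refine a maximal `1/2`-separated set, which has at most `5 ^ d` points, once by itself. -/
lemma exists_quarter_net (E : Type*) [NormedAddCommGroup E] [NormedSpace ℝ E]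
    [FiniteDimensional ℝ E] :
    ∃ N : Finset E, N.card ≤ 25 ^ Module.finrank ℝ E ∧ (∀ u ∈ N, ‖u‖ ≤ 3 / 2) ∧
      ∀ v : E, ‖v‖ ≤ 1 → ∃ u ∈ N, ‖v - u‖ ≤ 1 / 4 := by
  classical
  let Pr : Finset E → Prop := fun s =>
    (∀ c ∈ s, ‖c‖ ≤ 2) ∧ ∀ c ∈ s, ∀ d ∈ s, c ≠ d → 1 ≤ ‖c - d‖
  have hbd : ∀ s, Pr s → s.card ≤ 5 ^ Module.finrank ℝ E := fun s hs =>
    Besicovitch.card_le_of_separated s hs.1 hs.2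
  let A : Set ℕ := {n | ∃ s, Pr s ∧ s.card = n}
  have hA : A.Nonempty := ⟨0, ∅, by simp [Pr], rfl⟩
  have hAb : BddAbove A := ⟨5 ^ Module.finrank ℝ E, by
    rintro n ⟨s, hs, rfl⟩
    exact hbd s hs⟩
  obtain ⟨M, hM, hMc⟩ := Nat.sSup_mem hA hAb
  have hnet : ∀ v : E, ‖v‖ ≤ 2 → ∃ c ∈ M, ‖v - c‖ ≤ 1 := by
    intro v hv
    by_contra! h
    have hvM : v ∉ M := fun hvM => by
      have := h v hvM
      simp at this
      linarith
    have hP : Pr (insert v M) := by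
      refine ⟨fun c hc => ?_, fun c hc d hd hcd => ?_⟩
      · rcases Finset.mem_insert.1 hc with rfl | hc
        exacts [hv, hM.1 c hc]
      · rcases Finset.mem_insert.1 hc with hcv | hcM <;>
          rcases Finset.mem_insert.1 hd with hdv | hdM
        · exact absurd (hcv.trans hdv.symm) hcd
        · rw [hcv]; exact (h d hdM).le
        · rw [hdv, norm_sub_rev]; exact (h c hcM).le
        · exact hM.2 c hcM d hdM hcd
    have h1 : (insert v M).card ≤ sSup A := le_csSup hAb ⟨_, hP, rfl⟩
    rw [Finset.card_insert_of_notMem hvM] at h1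
    omega
  refine ⟨Finset.image₂ (fun c d => (1 / 2 : ℝ) • c + (1 / 4 : ℝ) • d) M M, ?_, ?_, ?_⟩
  · refine (Finset.card_image₂_le _ _ _).trans ?_
    calc M.card * M.card ≤ 5 ^ Module.finrank ℝ E * 5 ^ Module.finrank ℝ E :=
          Nat.mul_le_mul (hbd M hM) (hbd M hM)
      _ = 25 ^ Module.finrank ℝ E := by rw [← mul_pow]; norm_num
  · intro u hu
    obtain ⟨c, hc, d, hd, rfl⟩ := Finset.mem_image₂.1 hu
    refine (norm_add_le _ _).trans ?_
    rw [norm_smul, norm_smul]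
    have h1 := hM.1 c hc
    have h2 := hM.1 d hd
    norm_num
    linarith
  · intro v hv
    obtain ⟨c, hc, hvc⟩ := hnet ((2 : ℝ) • v) (by rw [norm_smul]; norm_num; linarith)
    obtain ⟨d, hd, hvd⟩ := hnet ((2 : ℝ) • ((2 : ℝ) • v - c)) (by rw [norm_smul]; norm_num; linarith)
    refine ⟨_, Finset.mem_image₂_of_mem hc hd, ?_⟩
    have : v - ((1 / 2 : ℝ) • c + (1 / 4 : ℝ) • d) =
        (1 / 4 : ℝ) • ((2 : ℝ) • ((2 : ℝ) • v - c) - d) := by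
      module
    rw [this, norm_smul]
    norm_num
    linarith

/-- A symmetric bilinear form that is small on the diagonal over a `1/4`-net of the unit ball is
small on the whole diagonal. -/
lemma abs_le_of_quarter_net {E : Type*} [NormedAddCommGroup E] [InnerProductSpace ℝ E]
    [FiniteDimensional ℝ E] (D : E →ₗ[ℝ] E →ₗ[ℝ] ℝ) (hsymm : ∀ u v, D u v = D v u)
    {N : Finset E} (hN : ∀ v : E, ‖v‖ ≤ 1 → ∃ u ∈ N, ‖v - u‖ ≤ 1 / 4) {t : ℝ}
    (ht : ∀ u ∈ N, |D u u| ≤ t) (v : E) : |D v v| ≤ 16 / 7 * t * ‖v‖ ^ 2 := by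
  have hcont : Continuous fun v : E => |D v v| := by
    have h1 : Continuous fun v : E => (LinearMap.toContinuousLinearMap (D v)) v := by
      have h2 : Continuous fun v : E =>
          (LinearMap.toContinuousLinearMap.toLinearMap ∘ₗ D) v :=
        LinearMap.continuous_of_finiteDimensional _
      exact h2.clm_apply continuous_id
    exact h1.abs
  obtain ⟨v₀, hv₀, hmax⟩ := (isCompact_closedBall (0 : E) 1).exists_isMaxOn
    ⟨0, by simp⟩ hcont.continuousOn
  set M := |D v₀ v₀| with hM
  have hM0 : 0 ≤ M := abs_nonneg _
  have hhom : ∀ w : E, |D w w| ≤ M * ‖w‖ ^ 2 := by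
    intro w
    rcases eq_or_ne w 0 with rfl | hw
    · simp
    have hw' : ‖w‖ ≠ 0 := norm_ne_zero_iff.2 hw
    have h1 : |D (‖w‖⁻¹ • w) (‖w‖⁻¹ • w)| ≤ M := hmax (by
      simp [norm_smul, inv_mul_cancel₀ hw'])
    have h2 : D w w = ‖w‖ ^ 2 * D (‖w‖⁻¹ • w) (‖w‖⁻¹ • w) := by
      simp only [map_smul, LinearMap.smul_apply, smul_eq_mul]
      field_simp
    rw [h2, abs_mul, abs_of_nonneg (sq_nonneg _), mul_comm]
    gcongr
  have hpolar : ∀ x y : E, ‖x‖ ≤ 1 / 4 → ‖y‖ ≤ 9 / 4 → |D x y| ≤ 9 / 16 * M := by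
    intro x y hx hy
    -- rescaling balances the two norms before polarization
    set a := (3 : ℝ) • x with ha
    set b := (1 / 3 : ℝ) • y with hb
    have hab : D x y = D a b := by simp [ha, hb]
    have hna : ‖a‖ ≤ 3 / 4 := by rw [ha, norm_smul]; norm_num; linarith
    have hnb : ‖b‖ ≤ 3 / 4 := by rw [hb, norm_smul]; norm_num; linarith
    have hpol : 4 * D a b = D (a + b) (a + b) - D (a - b) (a - b) := by
      simp only [map_add, map_sub, LinearMap.add_apply, LinearMap.sub_apply]
      rw [hsymm b a]
      ring
    have h1 := abs_le.1 (hhom (a + b))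
    have h2 := abs_le.1 (hhom (a - b))
    have h3 : ‖a + b‖ ^ 2 + ‖a - b‖ ^ 2 ≤ 9 / 4 := by
      have := parallelogram_law_with_norm ℝ a b
      nlinarith [norm_nonneg a, norm_nonneg b]
    have h4 : M * (‖a + b‖ ^ 2 + ‖a - b‖ ^ 2) ≤ M * (9 / 4) := by gcongr
    rw [hab, abs_le]
    constructor <;> linarith
  have hMt : M ≤ 16 / 7 * t := by
    have hv1 : ‖v₀‖ ≤ 1 := by simpa using hv₀
    obtain ⟨u, hu, huv⟩ := hN v₀ hv1
    have h1 : D v₀ v₀ = D u u + D (v₀ - u) (v₀ + u) := by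
      simp only [map_add, map_sub, LinearMap.sub_apply]
      rw [hsymm u v₀]
      ring
    have h2 : ‖v₀ + u‖ ≤ 9 / 4 := by
      have : v₀ + u = (2 : ℝ) • v₀ - (v₀ - u) := by module
      rw [this]
      refine (norm_sub_le _ _).trans ?_
      rw [norm_smul]
      norm_num
      linarith
    have h3 := hpolar _ _ huv h2
    have h4 : M ≤ t + 9 / 16 * M := by
      calc M = |D u u + D (v₀ - u) (v₀ + u)| := by rw [hM, h1]
        _ ≤ _ := (abs_add_le _ _).trans (add_le_add (ht u hu) h3)
    linarith
  exact (hhom v).trans (by gcongr)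

/-- On a subspace of dimension at most `k`, the deviation of the empirical second moment from the
covariance is controlled by its values at `25 ^ k` points. -/
lemma exists_net_of_finrank_le {p k : ℕ} {S : Matrix (Fin p) (Fin p) ℝ} (hS : S.PosDef)
    (W : Submodule ℝ (Vec p)) (hW : Module.finrank ℝ W ≤ k) :
    ∃ N : Finset (Vec p), N.card ≤ 25 ^ k ∧ (∀ u ∈ N, qf S u ≤ 9 / 4) ∧
      ∀ (n : ℕ) (x : Fin n → Vec p) (t : ℝ), (∀ u ∈ N, |empQ x u - qf S u| ≤ t) →
        ∀ v ∈ W, |empQ x v - qf S v| ≤ 16 / 7 * t * qf S v := by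
  classical
  obtain ⟨e, he⟩ := exists_linearEquiv_norm_sq_eq_qf hS
  let E := W.map (e : Vec p →ₗ[ℝ] Vec p)
  obtain ⟨N, hNc, hNn, hN⟩ := exists_quarter_net E
  refine ⟨N.image fun u : E => e.symm (u : Vec p), ?_, ?_, ?_⟩
  · refine Finset.card_image_le.trans (hNc.trans ?_)
    exact Nat.pow_le_pow_right (by norm_num) ((Submodule.finrank_map_le _ _).trans hW)
  · intro u hu
    obtain ⟨w, hw, rfl⟩ := Finset.mem_image.1 hu
    rw [← he, LinearEquiv.apply_symm_apply]
    have := hNn w hw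
    have h2 : ‖(w : Vec p)‖ ≤ 3 / 2 := this
    nlinarith [norm_nonneg (w : Vec p)]
  · intro n x t ht v hv
    let D : E →ₗ[ℝ] E →ₗ[ℝ] ℝ := LinearMap.mk₂ ℝ
      (fun u w => 1 / (n : ℝ) * ∑ i, inner ℝ (x i) (e.symm u) * inner ℝ (x i) (e.symm w)
        - inner ℝ (u : Vec p) (w : Vec p))
      (fun a b c => by
        simp only [Submodule.coe_add, map_add, inner_add_right, inner_add_left, add_mul,
          Finset.sum_add_distrib]; ring)
      (fun r a c => by
        simp only [Submodule.coe_smul, map_smul, inner_smul_right, inner_smul_left, mul_assoc,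
          ← Finset.mul_sum, smul_eq_mul, RCLike.conj_to_real]; ring)
      (fun a b c => by
        simp only [Submodule.coe_add, map_add, inner_add_right, mul_add,
          Finset.sum_add_distrib]; ring)
      (fun r a c => by
        simp only [Submodule.coe_smul, map_smul, inner_smul_right, mul_left_comm _ r,
          ← Finset.mul_sum, smul_eq_mul]; ring)
    have hD : ∀ u : E, D u u = empQ x (e.symm u) - qf S (e.symm u) := fun u => by
      rw [← he, LinearEquiv.apply_symm_apply, ← real_inner_self_eq_norm_sq]
      simp [D, empQ, sq]
    have hsymm : ∀ u w, D u w = D w u := fun u w => by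
      simp only [D, LinearMap.mk₂_apply]
      rw [real_inner_comm]
      congr 2
      exact Finset.sum_congr rfl fun i _ => mul_comm _ _
    have key := abs_le_of_quarter_net D hsymm hN (t := t)
      (fun u hu => by rw [hD]; exact ht _ (Finset.mem_image_of_mem _ hu))
      ⟨e v, Submodule.mem_map_of_mem hv⟩
    rw [hD] at key
    simpa [he] using key

/-- The coordinate subspace of vectors supported on `T`. -/
def coordSubspace {p : ℕ} (T : Finset (Fin p)) : Submodule ℝ (Vec p) where
  carrier := {v | ∀ i, i ∉ T → v i = 0}
  add_mem' {v w} hv hw i hi := by simp [hv i hi, hw i hi]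
  zero_mem' i _ := by simp
  smul_mem' c v hv i hi := by simp [hv i hi]

lemma finrank_coordSubspace_le {p : ℕ} (T : Finset (Fin p)) :
    Module.finrank ℝ (coordSubspace T) ≤ T.card := by
  let φ : coordSubspace T →ₗ[ℝ] (T → ℝ) :=
    { toFun := fun v i => (v : Vec p) i
      map_add' := fun v w => by ext i; simp
      map_smul' := fun c v => by ext i; simp }
  have hφ : Function.Injective φ := by
    rw [← LinearMap.ker_eq_bot, LinearMap.ker_eq_bot']
    intro v hv
    ext i
    by_cases hi : i ∈ T
    · exact congrFun hv ⟨i, hi⟩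
    · exact v.2 i hi
  simpa using LinearMap.finrank_le_finrank_of_injective hφ

/-- The deviation of the empirical second moment from the covariance, over all `k`-sparse vectors,
is controlled by its values at `(25 p) ^ k` points. -/
lemma exists_net_sparse {p k : ℕ} (hp : 0 < p) {S : Matrix (Fin p) (Fin p) ℝ} (hS : S.PosDef) :
    ∃ N : Finset (Vec p), N.card ≤ (25 * p) ^ k ∧ (∀ u ∈ N, qf S u ≤ 9 / 4) ∧
      ∀ (n : ℕ) (x : Fin n → Vec p) (t : ℝ), (∀ u ∈ N, |empQ x u - qf S u| ≤ t) →
        ∀ v : Vec p, l0norm v ≤ k → |empQ x v - qf S v| ≤ 16 / 7 * t * qf S v := by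
  classical
  let 𝒯 := Finset.powersetCard (min k p) (Finset.univ : Finset (Fin p))
  have hT : ∀ T : Finset (Fin p), ∃ N : Finset (Vec p), T ∈ 𝒯 → N.card ≤ 25 ^ k ∧
      (∀ u ∈ N, qf S u ≤ 9 / 4) ∧
      ∀ (n : ℕ) (x : Fin n → Vec p) (t : ℝ), (∀ u ∈ N, |empQ x u - qf S u| ≤ t) →
        ∀ v ∈ coordSubspace T, |empQ x v - qf S v| ≤ 16 / 7 * t * qf S v := by
    intro T
    by_cases h : T ∈ 𝒯
    · obtain ⟨N, hN⟩ := exists_net_of_finrank_le (k := k) hS (coordSubspace T)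
        ((finrank_coordSubspace_le T).trans
          (((Finset.mem_powersetCard.1 h).2).le.trans (min_le_left _ _)))
      exact ⟨N, fun _ => hN⟩
    · exact ⟨∅, fun h' => absurd h' h⟩
  choose N hN using hT
  refine ⟨𝒯.biUnion N, ?_, ?_, ?_⟩
  · refine Finset.card_biUnion_le.trans ((Finset.sum_le_sum fun T hT => (hN T hT).1).trans ?_)
    rw [Finset.sum_const, smul_eq_mul, mul_pow, mul_comm]
    gcongr
    rw [Finset.card_powersetCard, Finset.card_univ, Fintype.card_fin]
    exact (Nat.choose_le_pow _ _).trans (Nat.pow_le_pow_right hp (min_le_left _ _))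
  · intro u hu
    obtain ⟨T, hT, hu⟩ := Finset.mem_biUnion.1 hu
    exact (hN T hT).2.1 u hu
  · intro n x t ht v hv
    obtain ⟨T, hvT, hTc⟩ : ∃ T, supp v ⊆ T ∧ T.card = min k p := by
      apply Finset.exists_superset_card_eq
      · rw [card_supp]
        exact le_min hv (l0norm_le_dim v)
      · simp
    have hT : T ∈ 𝒯 := Finset.mem_powersetCard.2 ⟨Finset.subset_univ _, hTc⟩
    refine (hN T hT).2.2 n x t (fun u hu => ht u (Finset.mem_biUnion.2 ⟨T, hT, hu⟩)) v ?_
    intro i hi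
    by_contra h0
    exact hi (hvT (mem_supp.2 h0))

/-! ### Concentration of squares of sub-Gaussian variables -/

lemma hasSubgaussianMGF_mono {Ω : Type*} [MeasurableSpace Ω] {μ : Measure Ω} {Z : Ω → ℝ}
    {c c' : ℝ≥0} (h : HasSubgaussianMGF Z c μ) (hc : c ≤ c') : HasSubgaussianMGF Z c' μ :=
  ⟨h.integrable_exp_mul, fun t => (h.mgf_le t).trans (by gcongr)⟩

lemma lintegral_exp_mul_gaussianReal (a : ℝ) :
    ∫⁻ g, ENNReal.ofReal (Real.exp (a * g)) ∂(gaussianReal 0 1) =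
      ENNReal.ofReal (Real.exp (a ^ 2 / 2)) := by
  rw [← ofReal_integral_eq_lintegral_ofReal (integrable_exp_mul_gaussianReal a)
    (Filter.Eventually.of_forall fun _ => (Real.exp_pos _).le)]
  have := mgf_gaussianReal (p := gaussianReal 0 1) (X := id) (μ := 0) (v := 1) (by simp) a
  rw [mgf] at this
  simp only [id] at this
  rw [this]
  simp

lemma lintegral_exp_sq_div_four_gaussianReal :
    ∫⁻ g, ENNReal.ofReal (Real.exp (g ^ 2 / 4)) ∂(gaussianReal 0 1) = ENNReal.ofReal (√2) := by
  rw [gaussianReal_of_var_ne_zero 0 one_ne_zero,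
    lintegral_withDensity_eq_lintegral_mul _ (measurable_gaussianPDF 0 1) (by fun_prop)]
  have h1 : ∀ g : ℝ, (gaussianPDF 0 1 * fun g => ENNReal.ofReal (Real.exp (g ^ 2 / 4))) g =
      ENNReal.ofReal ((√(2 * Real.pi))⁻¹ * Real.exp (-(1 / 4) * g ^ 2)) := fun g => by
    rw [Pi.mul_apply, gaussianPDF, ← ENNReal.ofReal_mul (gaussianPDFReal_nonneg _ _ _),
      gaussianPDFReal, mul_assoc, ← Real.exp_add]
    congr 2
    · simp
    · congr 1
      simp
      ring
  simp_rw [h1]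
  rw [← ofReal_integral_eq_lintegral_ofReal
    ((integrable_exp_neg_mul_sq (by norm_num)).const_mul _)
    (Filter.Eventually.of_forall fun _ => by positivity), integral_const_mul, integral_gaussian]
  congr 1
  rw [← Real.sqrt_inv, ← Real.sqrt_mul (by positivity)]
  congr 1
  have := Real.pi_ne_zero
  field_simp
  norm_num

/-- The square of a sub-Gaussian variable is exponentially integrable. The Gaussian integral
`exp (z² / (4 c)) = ∫ exp (g z / √(2 c)) dγ(g)` reduces this to the moment generating function. -/
lemma lintegral_exp_sq_le {Ω : Type*} [MeasurableSpace Ω] {μ : Measure Ω} [IsProbabilityMeasure μ]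
    {Z : Ω → ℝ} {c : ℝ≥0} (hc : 0 < c) (h : HasSubgaussianMGF Z c μ) :
    ∫⁻ ω, ENNReal.ofReal (Real.exp (Z ω ^ 2 / (4 * c))) ∂μ ≤ ENNReal.ofReal (√2) := by
  have hZ := h.aemeasurable
  have hc' : (0 : ℝ) < c := hc
  set a : ℝ := (√(2 * c))⁻¹ with ha
  have ha2 : a ^ 2 = (2 * (c : ℝ))⁻¹ := by rw [ha, inv_pow, Real.sq_sqrt (by positivity)]
  calc ∫⁻ ω, ENNReal.ofReal (Real.exp (Z ω ^ 2 / (4 * c))) ∂μ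
      = ∫⁻ ω, ∫⁻ g, ENNReal.ofReal (Real.exp (a * Z ω * g)) ∂(gaussianReal 0 1) ∂μ := by
        refine lintegral_congr fun ω => ?_
        rw [lintegral_exp_mul_gaussianReal, mul_pow, ha2]
        congr 2
        field_simp
        norm_num
    _ = ∫⁻ g, ∫⁻ ω, ENNReal.ofReal (Real.exp (a * Z ω * g)) ∂μ ∂(gaussianReal 0 1) := by
        rw [lintegral_lintegral_swap]
        have h1 : AEMeasurable (fun q : Ω × ℝ => Z q.1) (μ.prod (gaussianReal 0 1)) := hZ.comp_fst
        have h2 : AEMeasurable (fun q : Ω × ℝ => q.2) (μ.prod (gaussianReal 0 1)) :=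
          measurable_snd.aemeasurable
        exact ((h1.const_mul a).mul h2).exp.ennreal_ofReal
    _ ≤ ∫⁻ g, ENNReal.ofReal (Real.exp (g ^ 2 / 4)) ∂(gaussianReal 0 1) := by
        refine lintegral_mono fun g => ?_
        have h1 : ∀ ω, a * Z ω * g = (a * g) * Z ω := fun ω => by ring
        simp_rw [h1]
        rw [← ofReal_integral_eq_lintegral_ofReal (h.integrable_exp_mul _)
          (Filter.Eventually.of_forall fun _ => (Real.exp_pos _).le)]
        refine ENNReal.ofReal_le_ofReal ((h.mgf_le (a * g)).trans (le_of_eq ?_))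
        rw [mul_pow, ha2]
        congr 1
        field_simp
        ring
    _ = _ := lintegral_exp_sq_div_four_gaussianReal

lemma exp_le_one_add_add (x : ℝ) : Real.exp x ≤ 1 + x + x ^ 2 * Real.exp |x| := by
  have h := Complex.norm_exp_sub_sum_le_norm_mul_exp (x : ℂ) 2
  have e : Complex.exp (x : ℂ) - ∑ m ∈ Finset.range 2, (x : ℂ) ^ m / (m.factorial : ℂ) =
      ((Real.exp x - (1 + x) : ℝ) : ℂ) := by
    simp [Finset.sum_range_succ]
  rw [e, Complex.norm_real, Complex.norm_real, Real.norm_eq_abs, Real.norm_eq_abs, sq_abs] at h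
  linarith [le_abs_self (Real.exp x - (1 + x))]

/-- The squares of sub-Gaussian variables are sub-exponential. -/
lemma integral_exp_mul_sq_le {Ω : Type*} [MeasurableSpace Ω] {μ : Measure Ω}
    [IsProbabilityMeasure μ] {Z : Ω → ℝ} {c : ℝ≥0} (hc : 0 < c) (h : HasSubgaussianMGF Z c μ)
    {l : ℝ} (hl : |l| ≤ 1 / (8 * c)) :
    Integrable (fun ω => Real.exp (l * Z ω ^ 2)) μ ∧
      ∫ ω, Real.exp (l * Z ω ^ 2) ∂μ ≤
        Real.exp (l * ∫ ω, Z ω ^ 2 ∂μ + 256 * c ^ 2 * l ^ 2) := by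
  have hc' : (0 : ℝ) < c := hc
  have hZ := h.aemeasurable
  have hmeas : AEStronglyMeasurable (fun ω => Real.exp (Z ω ^ 2 / (4 * c))) μ :=
    ((hZ.pow_const 2).div_const _).exp.aestronglyMeasurable
  have hle := lintegral_exp_sq_le hc h
  have hint : Integrable (fun ω => Real.exp (Z ω ^ 2 / (4 * c))) μ := by
    rw [← lintegral_ofReal_ne_top_iff_integrable hmeas
      (Filter.Eventually.of_forall fun _ => (Real.exp_pos _).le)]
    exact (hle.trans_lt ENNReal.ofReal_lt_top).ne
  have hB : ∫ ω, Real.exp (Z ω ^ 2 / (4 * c)) ∂μ ≤ 2 := by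
    have h1 : ∫ ω, Real.exp (Z ω ^ 2 / (4 * c)) ∂μ ≤ √2 := by
      rw [← ENNReal.ofReal_le_ofReal_iff (by positivity), ofReal_integral_eq_lintegral_ofReal hint
        (Filter.Eventually.of_forall fun _ => (Real.exp_pos _).le)]
      exact hle
    refine h1.trans ?_
    rw [Real.sqrt_le_left (by norm_num)]
    norm_num
  have hpt : ∀ z : ℝ, Real.exp (l * z ^ 2) ≤
      1 + l * z ^ 2 + 128 * c ^ 2 * l ^ 2 * Real.exp (z ^ 2 / (4 * c)) := by
    intro z
    have h1 := exp_le_one_add_add (l * z ^ 2)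
    have h2 : |l * z ^ 2| ≤ z ^ 2 / (8 * c) := by
      rw [abs_mul, abs_of_nonneg (sq_nonneg z)]
      calc |l| * z ^ 2 ≤ 1 / (8 * c) * z ^ 2 := by gcongr
        _ = _ := by ring
    have h3 : z ^ 4 ≤ 128 * c ^ 2 * Real.exp (z ^ 2 / (8 * c)) := by
      have h4 := Real.quadratic_le_exp_of_nonneg (x := z ^ 2 / (8 * c)) (by positivity)
      have h5 : (z ^ 2 / (8 * c)) ^ 2 / 2 ≤ Real.exp (z ^ 2 / (8 * c)) := by
        have : 0 ≤ z ^ 2 / (8 * c) := by positivity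
        linarith
      calc z ^ 4 = 128 * c ^ 2 * ((z ^ 2 / (8 * c)) ^ 2 / 2) := by field_simp; ring
        _ ≤ _ := by gcongr
    have h6 : (l * z ^ 2) ^ 2 * Real.exp |l * z ^ 2| ≤
        128 * c ^ 2 * l ^ 2 * Real.exp (z ^ 2 / (4 * c)) := by
      calc (l * z ^ 2) ^ 2 * Real.exp |l * z ^ 2|
          = l ^ 2 * z ^ 4 * Real.exp |l * z ^ 2| := by ring
        _ ≤ l ^ 2 * (128 * c ^ 2 * Real.exp (z ^ 2 / (8 * c))) * Real.exp (z ^ 2 / (8 * c)) := by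
            gcongr
        _ = 128 * c ^ 2 * l ^ 2 * (Real.exp (z ^ 2 / (8 * c)) * Real.exp (z ^ 2 / (8 * c))) := by
            ring
        _ = _ := by
            rw [← Real.exp_add]
            congr 2
            field_simp
            ring
    linarith
  have hZ2 : Integrable (fun ω => Z ω ^ 2) μ := (h.memLp 2).integrable_sq
  have hdom : Integrable (fun ω =>
      1 + l * Z ω ^ 2 + 128 * c ^ 2 * l ^ 2 * Real.exp (Z ω ^ 2 / (4 * c))) μ :=
    ((integrable_const 1).add (hZ2.const_mul l)).add (hint.const_mul _)
  have hI : Integrable (fun ω => Real.exp (l * Z ω ^ 2)) μ := by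
    refine hdom.mono' ((hZ.pow_const 2).const_mul l).exp.aestronglyMeasurable
      (Filter.Eventually.of_forall fun ω => ?_)
    rw [Real.norm_eq_abs, abs_of_pos (Real.exp_pos _)]
    exact hpt _
  refine ⟨hI, ?_⟩
  calc ∫ ω, Real.exp (l * Z ω ^ 2) ∂μ
      ≤ ∫ ω, (1 + l * Z ω ^ 2 + 128 * c ^ 2 * l ^ 2 * Real.exp (Z ω ^ 2 / (4 * c))) ∂μ :=
        integral_mono hI hdom fun ω => hpt _
    _ = 1 + l * ∫ ω, Z ω ^ 2 ∂μ +
          128 * c ^ 2 * l ^ 2 * ∫ ω, Real.exp (Z ω ^ 2 / (4 * c)) ∂μ := by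
        rw [integral_add (f := fun ω => 1 + l * Z ω ^ 2)
            ((integrable_const 1).add (hZ2.const_mul l)) (hint.const_mul _), integral_add (integrable_const 1) (hZ2.const_mul l), integral_const_mul,
          integral_const_mul]
        simp
    _ ≤ 1 + l * ∫ ω, Z ω ^ 2 ∂μ + 128 * c ^ 2 * l ^ 2 * 2 := by gcongr
    _ = (l * ∫ ω, Z ω ^ 2 ∂μ + 256 * c ^ 2 * l ^ 2) + 1 := by ring
    _ ≤ _ := Real.add_one_le_exp _

/-- Bernstein's inequality for averages of squares of independent sub-Gaussian variables, for
deviations `t` small enough for the exponent to be quadratic in `t`. -/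
lemma measureReal_abs_avg_sq_sub_gt_le {Ω : Type*} [MeasurableSpace Ω] {μ : Measure Ω}
    [IsProbabilityMeasure μ] {n : ℕ} (hn : 0 < n) {Z : Fin n → Ω → ℝ} {c : ℝ≥0} (hc : 0 < c)
    (h : ∀ i, HasSubgaussianMGF (Z i) c μ) (hindep : iIndepFun Z μ) {V t : ℝ}
    (hV : ∀ i, ∫ ω, Z i ω ^ 2 ∂μ = V) (ht0 : 0 ≤ t) (ht : t ≤ 64 * c) :
    μ.real {ω | t < |1 / (n : ℝ) * ∑ i, Z i ω ^ 2 - V|} ≤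
      2 * Real.exp (-(t ^ 2 / (1024 * c ^ 2)) * n) := by
  have hc' : (0 : ℝ) < c := hc
  have hn' : (0 : ℝ) < n := by exact_mod_cast hn
  set l := t / (512 * c ^ 2) with hl
  have hl0 : 0 ≤ l := by positivity
  have hl8 : l ≤ 1 / (8 * c) := by
    rw [hl, div_le_div_iff₀ (by positivity) (by positivity)]
    nlinarith
  let W : Fin n → Ω → ℝ := fun i ω => Z i ω ^ 2
  have hWm : ∀ i, AEMeasurable (W i) μ := fun i => (h i).aemeasurable.pow_const 2
  have hWind : iIndepFun W μ := hindep.comp (fun _ z => z ^ 2) fun _ => by fun_prop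
  have hmgf : ∀ l' : ℝ, |l'| = l → Integrable (fun ω => Real.exp (l' * (∑ i, W i) ω)) μ ∧
      mgf (∑ i, W i) μ l' ≤ Real.exp (n * (l' * V + 256 * c ^ 2 * l ^ 2)) := by
    intro l' hl'
    have hl8' : |l'| ≤ 1 / (8 * c) := hl'.le.trans hl8
    have hsq : l' ^ 2 = l ^ 2 := by rw [← hl', sq_abs]
    constructor
    · by_contra hni
      have h0 := mgf_undef hni
      rw [hWind.mgf_sum₀ hWm] at h0
      refine absurd h0 (Finset.prod_pos fun i _ => ?_).ne'
      exact mgf_pos (integral_exp_mul_sq_le hc (h i) hl8').1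
    · rw [hWind.mgf_sum₀ hWm]
      calc ∏ i, mgf (W i) μ l' ≤ ∏ _i : Fin n, Real.exp (l' * V + 256 * c ^ 2 * l ^ 2) := by
            refine Finset.prod_le_prod (fun _ _ => mgf_nonneg) fun i _ => ?_
            have := (integral_exp_mul_sq_le hc (h i) hl8').2
            rw [hV, hsq] at this
            exact this
        _ = _ := by
            rw [Finset.prod_const, Finset.card_univ, Fintype.card_fin, ← Real.exp_nat_mul]
  have hbound : n * (-(l * t) + 256 * c ^ 2 * l ^ 2) = -(t ^ 2 / (1024 * c ^ 2)) * n := by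
    rw [hl]; field_simp; ring
  have hup : μ.real {ω | n * (V + t) ≤ (∑ i, W i) ω} ≤
      Real.exp (-(t ^ 2 / (1024 * c ^ 2)) * n) := by
    obtain ⟨h1, h2⟩ := hmgf l (abs_of_nonneg hl0)
    refine (measure_ge_le_exp_mul_mgf _ hl0 h1).trans ?_
    refine (mul_le_mul_of_nonneg_left h2 (Real.exp_pos _).le).trans (le_of_eq ?_)
    rw [← Real.exp_add, ← hbound]
    congr 1
    ring
  have hlow : μ.real {ω | (∑ i, W i) ω ≤ n * (V - t)} ≤
      Real.exp (-(t ^ 2 / (1024 * c ^ 2)) * n) := by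
    obtain ⟨h1, h2⟩ := hmgf (-l) (by rw [abs_neg, abs_of_nonneg hl0])
    refine (measure_le_le_exp_mul_mgf _ (by linarith) h1).trans ?_
    refine (mul_le_mul_of_nonneg_left h2 (Real.exp_pos _).le).trans (le_of_eq ?_)
    rw [← Real.exp_add, ← hbound]
    congr 1
    ring
  calc μ.real {ω | t < |1 / (n : ℝ) * ∑ i, Z i ω ^ 2 - V|}
      ≤ μ.real ({ω | n * (V + t) ≤ (∑ i, W i) ω} ∪ {ω | (∑ i, W i) ω ≤ n * (V - t)}) := by
        refine measureReal_mono fun ω hω => ?_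
        simp only [Set.mem_ofPred_eq, Set.mem_union, Finset.sum_apply, W] at hω ⊢
        set A := ∑ i, Z i ω ^ 2
        have hA : A = n * (1 / n * A) := by field_simp
        rcases lt_abs.1 hω with h1 | h1
        · left
          rw [hA]
          gcongr
          linarith
        · right
          rw [hA]
          gcongr
          linarith
    _ ≤ _ := (measureReal_union_le _ _).trans (by linarith)

/-! ### The sub-Gaussian design -/

section Design

variable {p : ℕ} {K : ℝ≥0} {S : Matrix (Fin p) (Fin p) ℝ} {P : Measure (Vec p)}

lemma IsSubgaussianDesign.memLp_coord (h : IsSubgaussianDesign K S P) (j : Fin p) :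
    MemLp (fun x : Vec p => x j) 2 P := by
  have := (h.subgaussian (EuclideanSpace.single j 1)).memLp 2
  simpa [PiLp.inner_apply, PiLp.single_apply] using this

lemma IsSubgaussianDesign.integral_inner_sq (h : IsSubgaussianDesign K S P) (u : Vec p) :
    ∫ x, (inner ℝ u x) ^ 2 ∂P = qf S u := by
  have hcov : ∀ j l, ∫ x : Vec p, x j * x l ∂P = S j l := fun j l => by
    rw [← h.cov_eq j l, covariance, h.mean_eq, h.mean_eq]
    simp
  have hint : ∀ j l, Integrable (fun x : Vec p => x j * x l) P := fun j l =>
    (h.memLp_coord j).integrable_mul (h.memLp_coord l)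
  have h1 : ∀ x : Vec p, (inner ℝ u x) ^ 2 = ∑ j, ∑ l, u j * u l * (x j * x l) := fun x => by
    have : inner ℝ u x = ∑ j, u j * x j := by simp [PiLp.inner_apply, mul_comm]
    rw [this, sq, Finset.sum_mul_sum]
    refine Finset.sum_congr rfl fun j _ => Finset.sum_congr rfl fun l _ => by ring
  simp_rw [h1]
  rw [integral_finsetSum _ fun j _ => integrable_finsetSum _ fun l _ => (hint j l).const_mul _]
  simp only [qf, dotProduct, Matrix.mulVec, Finset.mul_sum]
  refine Finset.sum_congr rfl fun j _ => ?_
  rw [integral_finsetSum _ fun l _ => (hint j l).const_mul _]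
  refine Finset.sum_congr rfl fun l _ => ?_
  rw [integral_const_mul, hcov]
  ring

/-- With high probability the empirical second moment is close to the covariance, uniformly over
all `k`-sparse directions. -/
lemma measure_exists_sparse_dev_le {Ω : Type*} [MeasurableSpace Ω] {μ : Measure Ω}
    [IsProbabilityMeasure μ] {n k : ℕ} (hn : 0 < n) (hp : 0 < p) (hS : S.PosDef)
    (hP : IsSubgaussianDesign K S P) {X : Fin n → Ω → Vec p} (hX : ∀ i, HasLaw (X i) P μ)
    (hind : iIndepFun X μ) {t : ℝ} (ht0 : 0 ≤ t) (ht : t ≤ 1) {c : ℝ≥0}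
    (hc : c = 9 / 4 * (K ^ 2 + 1)) :
    μ {ω | ∃ v : Vec p, l0norm v ≤ k ∧
      16 / 7 * t * qf S v < |empQ (fun i => X i ω) v - qf S v|} ≤
      ENNReal.ofReal ((25 * p) ^ k * (2 * Real.exp (-(t ^ 2 / (1024 * c ^ 2)) * n))) := by
  obtain ⟨N, hNc, hNq, hN⟩ := exists_net_sparse (k := k) hp hS
  have hc0 : 0 < c := by rw [hc]; positivity
  have hc1 : (1 : ℝ) ≤ c := by
    rw [hc]; push_cast
    nlinarith [sq_nonneg (K : ℝ)]
  have hpt : ∀ u ∈ N, μ {ω | t < |empQ (fun i => X i ω) u - qf S u|} ≤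
      ENNReal.ofReal (2 * Real.exp (-(t ^ 2 / (1024 * c ^ 2)) * n)) := by
    intro u hu
    let Z : Fin n → Ω → ℝ := fun i ω => inner ℝ u (X i ω)
    have hsub : ∀ i, HasSubgaussianMGF (Z i) c μ := fun i => by
      have h1 := hP.subgaussian u
      rw [← (hX i).map_eq] at h1
      refine hasSubgaussianMGF_mono (HasSubgaussianMGF.of_map (hX i).aemeasurable h1) ?_
      rw [hc, mul_comm]
      have h2 : (qf S u).toNNReal ≤ 9 / 4 := by
        rw [Real.toNNReal_le_iff_le_coe]
        push_cast
        exact hNq u hu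
      exact mul_le_mul h2 (le_add_of_nonneg_right zero_le_one) (by positivity) (by positivity)
    have hZind : iIndepFun Z μ := hind.comp (fun _ x => inner ℝ u x) fun _ => by fun_prop
    have hV : ∀ i, ∫ ω, Z i ω ^ 2 ∂μ = qf S u := fun i => by
      rw [← hP.integral_inner_sq u]
      exact (hX i).integral_comp (f := fun x => (inner ℝ u x) ^ 2) (by fun_prop)
    have := measureReal_abs_avg_sq_sub_gt_le hn hc0 hsub hZind hV ht0 (by linarith)
    rw [← ofReal_measureReal]
    refine ENNReal.ofReal_le_ofReal (le_trans (le_of_eq ?_) this)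
    simp only [Z, empQ, real_inner_comm u]
  calc μ {ω | ∃ v : Vec p, l0norm v ≤ k ∧
      16 / 7 * t * qf S v < |empQ (fun i => X i ω) v - qf S v|}
      ≤ μ (⋃ u ∈ N, {ω | t < |empQ (fun i => X i ω) u - qf S u|}) := by
        refine measure_mono fun ω hω => ?_
        obtain ⟨v, hv, hlt⟩ := hω
        by_contra hcon
        simp only [Set.mem_iUnion, Set.mem_ofPred_eq, not_exists, not_lt] at hcon
        exact absurd (hN n _ t hcon v hv) (not_le.2 hlt)
    _ ≤ ∑ u ∈ N, μ {ω | t < |empQ (fun i => X i ω) u - qf S u|} :=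
        measure_biUnion_finset_le _ _
    _ ≤ ∑ _u ∈ N, ENNReal.ofReal (2 * Real.exp (-(t ^ 2 / (1024 * c ^ 2)) * n)) :=
        Finset.sum_le_sum hpt
    _ = ENNReal.ofReal (N.card * (2 * Real.exp (-(t ^ 2 / (1024 * c ^ 2)) * n))) := by
        rw [Finset.sum_const, nsmul_eq_mul,
          ENNReal.ofReal_mul (Nat.cast_nonneg _), ENNReal.ofReal_natCast]
    _ ≤ _ := by
        refine ENNReal.ofReal_le_ofReal ?_
        gcongr
        exact_mod_cast hNc

end Design

/-! ### The Gaussian noise -/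

lemma hasSubgaussianMGF_of_hasLaw_gaussianReal {Ω : Type*} [MeasurableSpace Ω] {μ : Measure Ω}
    {ξ : Ω → ℝ} {v : ℝ≥0} (h : HasLaw ξ (gaussianReal 0 v) μ) : HasSubgaussianMGF ξ v μ where
  integrable_exp_mul t := by
    have h1 := integrable_exp_mul_gaussianReal (μ := 0) (v := v) t
    rw [← h.map_eq] at h1
    exact h1.comp_aemeasurable h.aemeasurable
  mgf_le t := by
    rw [mgf_gaussianReal h.map_eq]
    simp

/-- A Gaussian tail bound that remains valid for `σ = 0`. -/
lemma measureReal_abs_gaussian_sum_gt_le {Ω : Type*} [MeasurableSpace Ω] {μ : Measure Ω}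
    [IsProbabilityMeasure μ] {n : ℕ} {σ : ℝ≥0} {ξ : Fin n → Ω → ℝ}
    (hlaw : ∀ i, HasLaw (ξ i) (gaussianReal 0 (σ ^ 2)) μ) (hind : iIndepFun ξ μ)
    (a : Fin n → ℝ) {A q : ℝ} (hA : 0 < A) (haA : ∑ i, a i ^ 2 ≤ A) (hq : 0 ≤ q) :
    μ.real {ω | σ * q < |∑ i, a i * ξ i ω|} ≤ 2 * Real.exp (-q ^ 2 / (2 * A)) := by
  have hsub : HasSubgaussianMGF (fun ω => ∑ i, a i * ξ i ω) (σ ^ 2 * A.toNNReal) μ := by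
    have hind' : iIndepFun (fun i ω => a i * ξ i ω) μ :=
      hind.comp (fun i z => a i * z) fun _ => by fun_prop
    refine hasSubgaussianMGF_mono (HasSubgaussianMGF.sum_of_iIndepFun hind'
      (s := Finset.univ) fun i _ =>
        (hasSubgaussianMGF_of_hasLaw_gaussianReal (hlaw i)).const_mul (a i)) ?_
    rw [← NNReal.coe_le_coe, NNReal.coe_sum]
    change ∑ i, a i ^ 2 * ((σ ^ 2 : ℝ≥0) : ℝ) ≤ _
    rw [← Finset.sum_mul, mul_comm, NNReal.coe_mul, Real.coe_toNNReal _ hA.le]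
    gcongr
  rcases eq_or_ne σ 0 with rfl | hσ
  · have h0 : (fun ω => ∑ i, a i * ξ i ω) =ᵐ[μ] 0 := by
      apply HasSubgaussianMGF.ae_eq_zero_of_hasSubgaussianMGF_zero
      simpa using hsub
    have : μ.real {ω | ((0 : ℝ≥0) : ℝ) * q < |∑ i, a i * ξ i ω|} = 0 := by
      rw [measureReal_eq_zero_iff]
      refine measure_mono_null (fun ω hω => ?_) h0
      simp only [NNReal.coe_zero, zero_mul, Set.mem_ofPred_eq, abs_pos] at hω
      exact hω
    rw [this]
    positivity
  have hσ' : (0 : ℝ) < σ := by exact_mod_cast pos_iff_ne_zero.2 hσ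
  have hexp : Real.exp (-(σ * q) ^ 2 / (2 * (σ ^ 2 * A.toNNReal : ℝ≥0))) =
      Real.exp (-q ^ 2 / (2 * A)) := by
    push_cast
    rw [Real.coe_toNNReal _ hA.le]
    congr 1
    field_simp
  have h1 := hsub.measure_ge_le (ε := σ * q) (by positivity)
  have h2 := hsub.neg.measure_ge_le (ε := σ * q) (by positivity)
  rw [hexp] at h1 h2
  calc μ.real {ω | σ * q < |∑ i, a i * ξ i ω|}
      ≤ μ.real ({ω | σ * q ≤ ∑ i, a i * ξ i ω} ∪
          {ω | σ * q ≤ (-fun ω => ∑ i, a i * ξ i ω) ω}) := by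
        refine measureReal_mono fun ω hω => ?_
        rw [Set.mem_ofPred_eq] at hω
        rcases lt_abs.1 hω with h | h
        · exact Or.inl h.le
        · exact Or.inr h.le
    _ ≤ _ := (measureReal_union_le _ _).trans (by linarith)

/-- With high probability, the noise is nearly uncorrelated with every column of the design whose
empirical second moment is at most `b`. The noise is independent of the design, so the bound holds
conditionally on the design. -/
lemma measure_exists_noise_corr_gt_le {Ω : Type*} [MeasurableSpace Ω] {μ : Measure Ω}
    [IsProbabilityMeasure μ] {n p : ℕ} (hn : 0 < n) {P : Measure (Vec p)} {σ : ℝ≥0}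
    {θbar : Vec p} {X : Fin n → Ω → Vec p} {ξ Y : Fin n → Ω → ℝ}
    (h : IsRegressionModel μ P σ θbar X ξ Y) {b q : ℝ} (hb : 0 < b) (hq : 0 ≤ q) :
    μ {ω | ∃ j, 1 / (n : ℝ) * ∑ i, (X i ω j) ^ 2 ≤ b ∧
      σ * q < |1 / (n : ℝ) * ∑ i, X i ω j * ξ i ω|} ≤
      ENNReal.ofReal (p * (2 * Real.exp (-(n * q ^ 2) / (2 * b)))) := by
  have hn' : (0 : ℝ) < n := by exact_mod_cast hn
  set G : Measure (Fin n → ℝ) := Measure.pi fun _ => gaussianReal 0 (σ ^ 2) with hG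
  set Xv : Ω → Fin n → Vec p := fun ω i => X i ω with hXv
  set ξv : Ω → Fin n → ℝ := fun ω i => ξ i ω with hξv
  have hXm : AEMeasurable Xv μ := aemeasurable_pi_lambda _ fun i => (h.design_law i).aemeasurable
  have hξl : HasLaw ξv G μ := iIndepFun.hasLaw_pi h.noise_law h.noise_indep
  have hXl : HasLaw Xv (μ.map Xv) μ := ⟨hXm, rfl⟩
  have : IsProbabilityMeasure (μ.map Xv) := Measure.isProbabilityMeasure_map hXm
  have hjoint : HasLaw (fun ω => (Xv ω, ξv ω)) ((μ.map Xv).prod G) μ :=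
    (indepFun_iff_hasLaw_prodMk_prod hXl hξl).1 h.design_noise_indep
  have hcoord_law : ∀ i, HasLaw (fun z : Fin n → ℝ => z i) (gaussianReal 0 (σ ^ 2)) G := fun i =>
    (measurePreserving_eval (fun _ : Fin n => gaussianReal 0 (σ ^ 2)) i).hasLaw
  have hcoord_ind : iIndepFun (fun (i : Fin n) (z : Fin n → ℝ) => z i) G :=
    iIndepFun_pi (X := fun _ => id) fun _ => aemeasurable_id
  have hj : ∀ j, μ {ω | 1 / (n : ℝ) * ∑ i, (X i ω j) ^ 2 ≤ b ∧
      σ * q < |1 / (n : ℝ) * ∑ i, X i ω j * ξ i ω|} ≤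
      ENNReal.ofReal (2 * Real.exp (-(n * q ^ 2) / (2 * b))) := by
    intro j
    let B : (Fin n → Vec p) × (Fin n → ℝ) → Prop := fun w =>
      1 / (n : ℝ) * ∑ i, (w.1 i j) ^ 2 ≤ b ∧ σ * q < |1 / (n : ℝ) * ∑ i, w.1 i j * w.2 i|
    have hc1 : ∀ i, Continuous fun w : (Fin n → Vec p) × (Fin n → ℝ) => w.1 i j := fun i =>
      (EuclideanSpace.proj (𝕜 := ℝ) j).continuous.comp ((continuous_apply i).comp continuous_fst)
    have hB : MeasurableSet {w | B w} := by
      have h1 : MeasurableSet {w : (Fin n → Vec p) × (Fin n → ℝ) |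
          1 / (n : ℝ) * ∑ i, (w.1 i j) ^ 2 ≤ b} := by
        refine measurableSet_le (Continuous.measurable ?_) measurable_const
        fun_prop
      have h2 : MeasurableSet {w : (Fin n → Vec p) × (Fin n → ℝ) |
          σ * q < |1 / (n : ℝ) * ∑ i, w.1 i j * w.2 i|} := by
        refine measurableSet_lt measurable_const (Continuous.measurable ?_)
        fun_prop
      exact h1.inter h2
    have e := hjoint.measure_eq hB
    change μ {ω | B (Xv ω, ξv ω)} ≤ _
    rw [e, Measure.prod_apply hB]
    calc ∫⁻ x, G (Prod.mk x ⁻¹' {w | B w}) ∂(μ.map Xv)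
        ≤ ∫⁻ _x, ENNReal.ofReal (2 * Real.exp (-(n * q ^ 2) / (2 * b))) ∂(μ.map Xv) := by
          refine lintegral_mono fun x => ?_
          by_cases hx : 1 / (n : ℝ) * ∑ i, (x i j) ^ 2 ≤ b
          · have hx' : ∑ i, (x i j) ^ 2 ≤ n * b := by
              rw [one_div, inv_mul_le_iff₀ hn'] at hx
              exact hx
            have := measureReal_abs_gaussian_sum_gt_le hcoord_law hcoord_ind (fun i => x i j)
              (by positivity) hx' (q := n * q) (by positivity)
            rw [← ofReal_measureReal]
            refine ENNReal.ofReal_le_ofReal ((measureReal_mono ?_).trans (this.trans (le_of_eq ?_)))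
            · intro z hz
              have hz2 := hz.2
              simp only [abs_mul, abs_of_pos (one_div_pos.2 hn')] at hz2
              rw [one_div, ← div_eq_inv_mul, lt_div_iff₀ hn'] at hz2
              change σ * (n * q) < _
              linarith
            · congr 2
              field_simp
          · rw [show Prod.mk x ⁻¹' {w | B w} = ∅ from
              Set.eq_empty_of_forall_notMem fun z hz => hx hz.1]
            simp
      _ = _ := by simp
  calc _ ≤ μ (⋃ j ∈ (Finset.univ : Finset (Fin p)), {ω | 1 / (n : ℝ) * ∑ i, (X i ω j) ^ 2 ≤ b ∧
        σ * q < |1 / (n : ℝ) * ∑ i, X i ω j * ξ i ω|}) := by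
        refine measure_mono fun ω hω => ?_
        obtain ⟨j, hj⟩ := hω
        simp only [Finset.mem_univ, Set.iUnion_true, Set.mem_iUnion]
        exact ⟨j, hj⟩
    _ ≤ ∑ _j : Fin p, ENNReal.ofReal (2 * Real.exp (-(n * q ^ 2) / (2 * b))) :=
        (measure_biUnion_finset_le _ _).trans (Finset.sum_le_sum fun j _ => hj j)
    _ = _ := by
        rw [Finset.sum_const, Finset.card_univ, Fintype.card_fin, nsmul_eq_mul,
          ENNReal.ofReal_mul (Nat.cast_nonneg _), ENNReal.ofReal_natCast]

/-! ### Estimation error -/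

/-- The basic inequality of least squares: `v = θ - θbar` satisfies
`empQ v ≤ ε + 2 λ ‖v‖₁`, and `‖v‖₁ ≤ √m ‖v‖₂` for an `m`-sparse difference. -/
lemma empQ_sub_le {n p m : ℕ} {x : Fin n → Vec p} {y ξ : Fin n → ℝ} {θbar θ : Vec p} {lam ε : ℝ}
    (hy : ∀ i, y i = inner ℝ θbar (x i) + ξ i)
    (hξ : ∀ j, |1 / (n : ℝ) * ∑ i, x i j * ξ i| ≤ lam) (hlam : 0 ≤ lam)
    (hm : l0norm (θ - θbar) ≤ m) (hε : lsLoss x y θ - lsLoss x y θbar ≤ ε) :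
    empQ x (θ - θbar) ≤ ε + 2 * (lam * √m) * ‖θ - θbar‖ := by
  set v := θ - θbar with hv
  have h1 : lsLoss x y θ - lsLoss x y θbar =
      empQ x v - 2 * ∑ j, v j * (1 / (n : ℝ) * ∑ i, x i j * ξ i) := by
    have h2 : ∑ j, v j * (1 / (n : ℝ) * ∑ i, x i j * ξ i) =
        1 / (n : ℝ) * ∑ i, inner ℝ (x i) v * ξ i := by
      have h3 : ∀ i, inner ℝ (x i) v = ∑ j, v j * x i j := fun i => by
        simp [PiLp.inner_apply]
      simp_rw [h3, Finset.sum_mul, Finset.mul_sum]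
      rw [Finset.sum_comm]
      exact Finset.sum_congr rfl fun i _ => Finset.sum_congr rfl fun j _ => by ring
    rw [h2, lsLoss, lsLoss, empQ, mul_left_comm, ← mul_sub, ← mul_sub, ← Finset.sum_sub_distrib,
      Finset.mul_sum (f := fun i => inner ℝ (x i) v * ξ i), ← Finset.sum_sub_distrib]
    congr 1
    refine Finset.sum_congr rfl fun i _ => ?_
    rw [hy, hv, inner_sub_right, real_inner_comm (x i) θbar]
    ring
  have h4 : ∑ j, v j * (1 / (n : ℝ) * ∑ i, x i j * ξ i) ≤ lam * √m * ‖v‖ := by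
    calc ∑ j, v j * (1 / (n : ℝ) * ∑ i, x i j * ξ i) ≤ ∑ j, |v j| * lam := by
          refine Finset.sum_le_sum fun j _ => (le_abs_self _).trans ?_
          rw [abs_mul]
          gcongr
          exact hξ j
      _ = lam * ∑ j, |v j| := by rw [← Finset.sum_mul, mul_comm]
      _ ≤ lam * (√(l0norm v) * ‖v‖) := by
          gcongr
          exact sum_abs_le_sqrt_mul_norm v
      _ ≤ lam * (√m * ‖v‖) := by gcongr
      _ = _ := by ring
  linarith

lemma le_add_sqrt_of_quadratic_le {M b ε r : ℝ} (hM : 0 < M) (hb : 0 ≤ b) (hε : 0 ≤ ε)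
    (h : M * r ^ 2 ≤ ε + 2 * b * r) : r ≤ 2 * b / M + √(ε / M) := by
  by_contra! hr
  have hq : 0 ≤ √(ε / M) := Real.sqrt_nonneg _
  have hbM : 0 ≤ 2 * b / M := by positivity
  have h1 : √(ε / M) ^ 2 = ε / M := Real.sq_sqrt (by positivity)
  have h2 : M * √(ε / M) ^ 2 = ε := by rw [h1]; field_simp
  have h3 : M * r ^ 2 - 2 * b * r = M * (r * (r - 2 * b / M)) := by field_simp
  have h4 : √(ε / M) ^ 2 < r * (r - 2 * b / M) := by
    nlinarith [mul_nonneg hbM (sub_nonneg.2 hr.le)]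
  nlinarith

/-- On the event that the empirical second moments are within `1/1000` of the covariance and the
noise is nearly uncorrelated with the columns, an `s`-sparse vector with small excess loss is close
to `θbar`. The constants satisfy `(2000 / 999)² * (101 / 50) * 2594 ≤ 145²`. -/
lemma estimation_error_le {n p s sstar k : ℕ} {S : Matrix (Fin p) (Fin p) ℝ} (hS : S.PosDef)
    (hp : 0 < p) (hss : 0 < sstar)
    (hs : s = ⌈2592 * kappa hS.isHermitian ^ 2 * (sstar : ℝ)⌉₊) (hk : k = 2 * s + sstar)
    {x : Fin n → Vec p} {y ξ : Fin n → ℝ} {θbar θ : Vec p} {σ : ℝ≥0} {ε : ℝ}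
    (hE : ∀ v : Vec p, l0norm v ≤ k → |empQ x v - qf S v| ≤ 1 / 1000 * qf S v)
    (hy : ∀ i, y i = inner ℝ θbar (x i) + ξ i)
    (hξ : ∀ j, |1 / (n : ℝ) * ∑ i, x i j * ξ i| ≤ σ * √(101 / 50 * (Real.log p / n)))
    (hθbar : l0norm θbar ≤ sstar) (hθ : l0norm θ ≤ s) (hε0 : 0 ≤ ε)
    (hε : lsLoss x y θ - lsLoss x y θbar ≤ ε) :
    ‖θbar - θ‖ ≤ 145 * (kappa hS.isHermitian / sigmaMin hS.isHermitian) * σ *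
      √(sstar * Real.log p / n) + 2 * √(ε / sigmaMin hS.isHermitian) := by
  have hmin := sigmaMin_pos hS hp
  have hκ := one_le_kappa hS hp
  have hm : l0norm (θ - θbar) ≤ s + sstar := (l0norm_sub_le _ _).trans (by omega)
  have h1 := empQ_sub_le hy hξ (by positivity) hm hε
  have h2 := (abs_le.1 (hE (θ - θbar) (by omega))).1
  have h3 := sigmaMin_mul_norm_sq_le_qf hS.isHermitian (θ - θbar)
  generalize sigmaMin hS.isHermitian = σm at *
  set κ := kappa hS.isHermitian with hκdef
  rw [norm_sub_rev]
  generalize ‖θ - θbar‖ = r at *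
  set A := √(Real.log p / n) with hA
  have hlam : √(101 / 50 * (Real.log p / n)) = √(101 / 50) * A := Real.sqrt_mul (by norm_num) _
  rw [hlam] at h1
  have hquad : 999 / 1000 * σm * r ^ 2 ≤
      ε + 2 * (σ * (√(101 / 50) * A) * √((s + sstar : ℕ) : ℝ)) * r := by linarith
  have h4 := le_add_sqrt_of_quadratic_le (by positivity) (by positivity) hε0 hquad
  refine h4.trans (add_le_add ?_ ?_)
  · have hsqrt : √(sstar * Real.log p / n) = √sstar * A := by
      rw [mul_div_assoc, Real.sqrt_mul (Nat.cast_nonneg _)]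
    have hsle : ((s + sstar : ℕ) : ℝ) ≤ 2594 * κ ^ 2 * sstar := by
      have h5 : (s : ℝ) < 2592 * κ ^ 2 * sstar + 1 := by
        rw [hs]; exact Nat.ceil_lt_add_one (by positivity)
      have h6 : (1 : ℝ) ≤ sstar := by exact_mod_cast hss
      have h7 : 1 ≤ κ ^ 2 := one_le_pow₀ hκ
      have h8 : (sstar : ℝ) ≤ κ ^ 2 * sstar := le_mul_of_one_le_left (by positivity) h7
      push_cast
      linarith
    have hnum : 2000 / 999 * (√(101 / 50) * √((s + sstar : ℕ) : ℝ)) ≤ 145 * κ * √sstar := by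
      refine (sq_le_sq₀ (by positivity) (by positivity)).1 ?_
      rw [mul_pow, mul_pow, mul_pow, mul_pow, Real.sq_sqrt (by norm_num),
        Real.sq_sqrt (Nat.cast_nonneg _), Real.sq_sqrt (Nat.cast_nonneg _)]
      have : 0 ≤ κ ^ 2 * (sstar : ℝ) := by positivity
      nlinarith
    rw [hsqrt]
    calc 2 * (σ * (√(101 / 50) * A) * √((s + sstar : ℕ) : ℝ)) / (999 / 1000 * σm)
        = (2000 / 999 * (√(101 / 50) * √((s + sstar : ℕ) : ℝ))) * (σ * A / σm) := by
          field_simp; ring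
      _ ≤ (145 * κ * √sstar) * (σ * A / σm) := by gcongr
      _ = _ := by ring
  · have : (2 : ℝ) = √4 := by
      rw [show (4 : ℝ) = 2 ^ 2 by norm_num, Real.sqrt_sq (by norm_num)]
    rw [this, ← Real.sqrt_mul (by norm_num)]
    apply Real.sqrt_le_sqrt
    rw [mul_div_assoc', div_le_div_iff₀ (by positivity) hmin]
    nlinarith [mul_nonneg hε0 hmin.le]

/-! ### The failure probabilities -/

/-- The union bound over the net is absorbed by the sample size. -/
lemma net_union_bound_le {n p k : ℕ} {c : ℝ} (hp : 2 ≤ p) (hk : 0 < k)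
    (hn : 14 * (k * Real.log p) ≤ c * n) :
    (25 * p : ℝ) ^ k * (2 * Real.exp (-c * n)) ≤ Real.exp (-(c / 2) * n) := by
  have hp' : (2 : ℝ) ≤ p := by exact_mod_cast hp
  have h1 : (25 * p : ℝ) ^ k * 2 ≤ (p : ℝ) ^ (7 * k) := by
    have h25 : (25 : ℝ) ≤ p ^ 5 := by
      calc (25 : ℝ) ≤ 2 ^ 5 := by norm_num
        _ ≤ p ^ 5 := by gcongr
    calc (25 * p : ℝ) ^ k * 2 ≤ ((p : ℝ) ^ 5 * p) ^ k * p ^ k := by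
          gcongr
          calc (2 : ℝ) ≤ p := hp'
            _ ≤ p ^ k := le_self_pow₀ (by linarith) hk.ne'
      _ = _ := by ring
  have h2 : (p : ℝ) ^ (7 * k) = Real.exp (7 * (k * Real.log p)) := by
    rw [← Real.exp_log (show (0 : ℝ) < p by linarith), ← Real.exp_nat_mul, Real.log_exp]
    push_cast
    ring_nf
  calc (25 * p : ℝ) ^ k * (2 * Real.exp (-c * n)) = ((25 * p : ℝ) ^ k * 2) * Real.exp (-c * n) := by
        ring
    _ ≤ Real.exp (7 * (k * Real.log p)) * Real.exp (-c * n) := by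
        rw [← h2]; gcongr
    _ = Real.exp (7 * (k * Real.log p) + -c * n) := by rw [Real.exp_add]
    _ ≤ _ := by
        apply Real.exp_le_exp.2
        linarith

/-- The exponent is `1 - 1010 / 1001 ≤ -1 / 125`: the factor `101 / 50` in the noise level is just
above the `2` that a union bound over `p` Gaussians needs. -/
lemma noise_union_bound_le {p : ℕ} (hp : 0 < p) :
    (p : ℝ) * (2 * Real.exp (-(101 / 50 * Real.log p) / (2 * (1001 / 1000)))) ≤
      2 * (p : ℝ) ^ (-(1 / 125) : ℝ) := by
  have hp' : (1 : ℝ) ≤ p := by exact_mod_cast hp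
  have hlog : 0 ≤ Real.log p := Real.log_nonneg hp'
  have hp0 : (0 : ℝ) < p := by linarith
  rw [Real.rpow_def_of_pos hp0]
  calc (p : ℝ) * (2 * Real.exp (-(101 / 50 * Real.log p) / (2 * (1001 / 1000))))
      = 2 * Real.exp (Real.log p + -(101 / 50 * Real.log p) / (2 * (1001 / 1000))) := by
        rw [Real.exp_add, Real.exp_log hp0]; ring
    _ ≤ _ := by
        gcongr
        have : -(101 / 50 * Real.log p) / (2 * (1001 / 1000)) = -(1010 / 1001) * Real.log p := by ring
        linarith

/-! ### The guarantees on the good event -/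

/-- The whole conclusion holds deterministically once the empirical second moments are within
`1/1000` of the covariance and the noise is nearly uncorrelated with the columns. -/
lemma lsLoss_guarantees {n p s sstar k : ℕ} {S : Matrix (Fin p) (Fin p) ℝ} (hS : S.PosDef)
    (hp : 0 < p) (hss : 0 < sstar)
    (hs : s = ⌈2592 * kappa hS.isHermitian ^ 2 * (sstar : ℝ)⌉₊) (hk : k = 2 * s + sstar)
    {x : Fin n → Vec p} {y ξ : Fin n → ℝ} {θbar : Vec p} {σ : ℝ≥0}
    (hE : ∀ v : Vec p, l0norm v ≤ k → |empQ x v - qf S v| ≤ 1 / 1000 * qf S v)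
    (hy : ∀ i, y i = inner ℝ θbar (x i) + ξ i)
    (hξ : ∀ j, |1 / (n : ℝ) * ∑ i, x i j * ξ i| ≤ σ * √(101 / 50 * (Real.log p / n)))
    (hθbar : l0norm θbar ≤ sstar) :
    RSC (lsLoss x y) k (1 / 4 * sigmaMin hS.isHermitian) ∧
    RSS (lsLoss x y) k (9 / 4 * sigmaMax hS.isHermitian) ∧
    ∀ α L : ℝ, 1 / 4 * sigmaMin hS.isHermitian ≤ α → RSC (lsLoss x y) k α →
      0 < L → L ≤ 9 / 4 * sigmaMax hS.isHermitian → RSS (lsLoss x y) k L →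
    ∀ (θ : ℕ → Vec p) (θstar : Vec p), IsIHT (lsLoss x y) s (2 / (3 * L)) θ →
      IsSparseMinimizer (lsLoss x y) sstar θstar →
      (∀ (ε : ℝ) (τ : ℕ), 0 < ε →
        4 * (L / α) * Real.log (lsLoss x y (θ 0) / ε) ≤ τ →
        lsLoss x y (θ τ) - lsLoss x y θstar ≤ ε) ∧
      (∀ (ε : ℝ) (τ : ℕ), 0 ≤ ε → lsLoss x y (θ τ) - lsLoss x y θstar ≤ ε →
        ‖θbar - θ τ‖ ≤ 145 * (kappa hS.isHermitian / sigmaMin hS.isHermitian) * σ *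
          √(sstar * Real.log p / n) + 2 * √(ε / sigmaMin hS.isHermitian)) := by
  have hmin := sigmaMin_pos hS hp
  have hκ := one_le_kappa hS hp
  refine ⟨RSC_lsLoss fun v hv => ?_, RSS_lsLoss fun v hv => ?_, ?_⟩
  · have h1 := (abs_le.1 (hE v hv)).1
    have h2 := sigmaMin_mul_norm_sq_le_qf hS.isHermitian v
    have h3 : 0 ≤ sigmaMin hS.isHermitian * ‖v‖ ^ 2 := by positivity
    linarith
  · have h1 := (abs_le.1 (hE v hv)).2
    have h2 := qf_le_sigmaMax_mul_norm_sq hS.isHermitian v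
    have h3 := qf_nonneg hS v
    linarith
  intro α L hα hC hL hL' hRS θ θstar hθ hstar
  refine ⟨fun ε τ hε hτ => ?_, fun ε τ hε hτ => ?_⟩
  · have hα0 : 0 < α := by linarith
    have hαL : α ≤ L := hC.le_of_RSS hp (by omega) hRS
    have hsle : 2592 * kappa hS.isHermitian ^ 2 * (sstar : ℝ) ≤ s := by
      rw [hs]; exact Nat.le_ceil _
    have hs0 : 0 < s := by
      have h1 : (0 : ℝ) < s := lt_of_lt_of_le
        (by have : (0 : ℝ) < sstar := by exact_mod_cast hss
            positivity) hsle
      exact_mod_cast h1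
    -- `L / α ≤ 9 κ`, and `2592 = 32 * 9 ^ 2`
    have hLα : L ≤ 9 * kappa hS.isHermitian * α := by
      have h1 : sigmaMax hS.isHermitian = kappa hS.isHermitian * sigmaMin hS.isHermitian := by
        rw [kappa]; field_simp
      have h2 : kappa hS.isHermitian * (1 / 4 * sigmaMin hS.isHermitian) ≤
        kappa hS.isHermitian * α := by gcongr
      linarith
    have hs32 : 32 * L ^ 2 * sstar ≤ α ^ 2 * s := by
      calc 32 * L ^ 2 * (sstar : ℝ) ≤ 32 * (9 * kappa hS.isHermitian * α) ^ 2 * sstar := by gcongr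
        _ = α ^ 2 * (2592 * kappa hS.isHermitian ^ 2 * (sstar : ℝ)) := by ring
        _ ≤ α ^ 2 * s := by gcongr
    exact hθ.converges hα0 hL hαL hk hs32 hs0 hC hRS (lsLoss_nonneg x y) hstar.1 hε hτ
  · refine estimation_error_le hS hp hss hs hk hE hy hξ hθbar (hθ.l0norm_le τ) hε ?_
    have := hstar.2 θbar hθbar
    linarith

end SparseRegression


theorem mainTheorem6 :
    ∃ C c₂ c₃ : ℝ, 0 < C ∧ 0 < c₂ ∧ 0 < c₃ ∧
    ∀ K : ℝ≥0, ∃ c₀ c₁ : ℝ, 0 < c₀ ∧ 0 < c₁ ∧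
    ∀ (Ω : Type*) [MeasurableSpace Ω] (μ : Measure Ω) [IsProbabilityMeasure μ]
      (n p sstar : ℕ) (S : Matrix (Fin p) (Fin p) ℝ) (hS : S.PosDef)
      (P : Measure (SparseRegression.Vec p)) (σ : ℝ≥0) (θbar : SparseRegression.Vec p)
      (X : Fin n → Ω → SparseRegression.Vec p) (ξ Y : Fin n → Ω → ℝ) (s k : ℕ),
      0 < p →
      (∀ j, S j j ≤ 1) →
      SparseRegression.IsSubgaussianDesign K S P →
      SparseRegression.IsRegressionModel μ P σ θbar X ξ Y →
      SparseRegression.l0norm θbar ≤ sstar →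
      s = ⌈2592 * SparseRegression.kappa hS.isHermitian ^ 2 * (sstar : ℝ)⌉₊ →
      k = 2 * s + sstar →
      c₁ * (k * Real.log p) / SparseRegression.sigmaMin hS.isHermitian < n →
      -- Up to the stated failure probability, all of the following hold simultaneously.
      μ {ω | ¬ (
          let f := SparseRegression.lsLoss (fun i => X i ω) (fun i => Y i ω)
          let σmin := SparseRegression.sigmaMin hS.isHermitian
          let σmax := SparseRegression.sigmaMax hS.isHermitian
          let κ := SparseRegression.kappa hS.isHermitian
          SparseRegression.RSC f k (1 / 4 * σmin) ∧
          SparseRegression.RSS f k (9 / 4 * σmax) ∧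
          ∀ α L : ℝ, 1 / 4 * σmin ≤ α → SparseRegression.RSC f k α →
            0 < L → L ≤ 9 / 4 * σmax → SparseRegression.RSS f k L →
          ∀ (θ : ℕ → SparseRegression.Vec p) (θstar : SparseRegression.Vec p),
            SparseRegression.IsIHT f s (2 / (3 * L)) θ →
            SparseRegression.IsSparseMinimizer f sstar θstar →
            -- the iteration count that guarantees function value error `ε`
            (∀ (ε : ℝ) (τ : ℕ), 0 < ε → C * (L / α) * Real.log (f (θ 0) / ε) ≤ τ →
              f (θ τ) - f θstar ≤ ε) ∧
            -- the estimation error of any iterate with function value error at most `ε`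
            (∀ (ε : ℝ) (τ : ℕ), 0 ≤ ε → f (θ τ) - f θstar ≤ ε →
              ‖θbar - θ τ‖ ≤
                145 * (κ / σmin) * σ * √(sstar * Real.log p / n) + 2 * √(ε / σmin)))}
        ≤ ENNReal.ofReal (Real.exp (-c₀ * n) + c₂ * (p : ℝ) ^ (-c₃)) := by
  refine ⟨4, 2, 1 / 125, by norm_num, by norm_num, by norm_num, fun K => ?_⟩
  obtain ⟨c, hc⟩ : ∃ c : ℝ≥0, c = 9 / 4 * (K ^ 2 + 1) := ⟨_, rfl⟩
  have hc0 : (0 : ℝ) < c := by rw [hc]; positivity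
  -- the exponent of Bernstein's inequality for the deviation `t = 1 / 3000`
  obtain ⟨c', hc'⟩ : ∃ c' : ℝ, c' = (1 / 3000) ^ 2 / (1024 * (c : ℝ) ^ 2) := ⟨_, rfl⟩
  have hc'0 : 0 < c' := by rw [hc']; positivity
  refine ⟨c' / 2, 14 / c', by positivity, by positivity, ?_⟩
  intro Ω _ μ _ n p sstar S hS P σ θbar X ξ Y s k hp hSd hP hM hθbar hs hk hn
  have hmin := SparseRegression.sigmaMin_pos hS hp
  have hp1 : (1 : ℝ) ≤ p := by exact_mod_cast hp
  have hlog : 0 ≤ Real.log p := Real.log_nonneg hp1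
  have hn0 : 0 < n := by
    have h1 : (0 : ℝ) < n := lt_of_le_of_lt (by positivity) hn
    exact_mod_cast h1
  have hn0' : (0 : ℝ) < n := by exact_mod_cast hn0
  rcases Nat.eq_zero_or_pos sstar with hss | hss
  · -- at sparsity level zero all vectors in play vanish
    subst hss
    have hs0 : s = 0 := by rw [hs]; simp
    have hk0 : k = 0 := by omega
    subst hs0 hk0
    refine le_of_eq_of_le ?_ zero_le
    convert measure_empty (μ := μ)
    refine Set.eq_empty_of_forall_notMem fun ω hω => hω ?_
    refine ⟨SparseRegression.RSC_lsLoss fun v hv => ?_,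
      SparseRegression.RSS_lsLoss fun v hv => ?_, ?_⟩
    · simp [SparseRegression.eq_zero_of_l0norm hv, SparseRegression.empQ]
    · simp [SparseRegression.eq_zero_of_l0norm hv, SparseRegression.empQ]
    · intro α L _ _ _ _ _ θ θstar hθ hstar
      have h1 : ∀ t, θ t = 0 := fun t => SparseRegression.eq_zero_of_l0norm (hθ.l0norm_le t)
      have h2 : θstar = 0 := SparseRegression.eq_zero_of_l0norm hstar.1
      have h3 : θbar = 0 := SparseRegression.eq_zero_of_l0norm hθbar
      refine ⟨fun ε τ hε _ => ?_, fun ε τ hε _ => ?_⟩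
      · rw [h1, h2, sub_self]; exact hε.le
      · rw [h1, h3, sub_self, norm_zero]
        simp
  rcases Nat.lt_or_ge p 2 with hp2 | hp2
  · -- for `p = 1` the bound exceeds one
    have hp1 : p = 1 := by omega
    subst hp1
    refine prob_le_one.trans ?_
    rw [← ENNReal.ofReal_one]
    refine ENNReal.ofReal_le_ofReal ?_
    have := Real.exp_pos (-(c' / 2) * n)
    rw [Nat.cast_one, Real.one_rpow]
    linarith
  have hk0 : 0 < k := by omega
  -- `σ_min ≤ 1`, so the sample size condition holds without the factor `1 / σ_min`
  have hmin1 : SparseRegression.sigmaMin hS.isHermitian ≤ 1 := by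
    have h1 := SparseRegression.sigmaMin_mul_norm_sq_le_qf hS.isHermitian
      (EuclideanSpace.single ⟨0, hp⟩ 1)
    rw [SparseRegression.qf_single] at h1
    simp only [PiLp.norm_single, norm_one, one_pow, mul_one] at h1
    exact h1.trans (hSd _)
  have hnk : 14 * (k * Real.log p) ≤ c' * n := by
    rw [div_lt_iff₀ hmin] at hn
    have h1 : (n : ℝ) * SparseRegression.sigmaMin hS.isHermitian ≤ n :=
      mul_le_of_le_one_right hn0'.le hmin1
    have h2 := hn.le.trans h1
    rw [div_mul_eq_mul_div, div_le_iff₀ hc'0] at h2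
    linarith
  have hB1 := SparseRegression.measure_exists_sparse_dev_le (k := k) hn0 hp hS hP hM.design_law
    hM.design_indep (t := 1 / 3000) (by norm_num) (by norm_num) hc
  rw [← hc'] at hB1
  have hB2 := SparseRegression.measure_exists_noise_corr_gt_le hn0 hM (b := 1001 / 1000)
    (q := √(101 / 50 * (Real.log p / n))) (by norm_num) (by positivity)
  have hq : (n : ℝ) * √(101 / 50 * (Real.log p / n)) ^ 2 = 101 / 50 * Real.log p := by
    rw [Real.sq_sqrt (by positivity)]; field_simp
  rw [hq] at hB2
  have hB1' := hB1.trans (ENNReal.ofReal_le_ofReal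
    (SparseRegression.net_union_bound_le hp2 hk0 hnk))
  have hB2' := hB2.trans (ENNReal.ofReal_le_ofReal (SparseRegression.noise_union_bound_le hp))
  rw [ENNReal.ofReal_add (Real.exp_pos _).le (by positivity)]
  refine le_trans (measure_mono fun ω hω => ?_)
    ((measure_union_le _ _).trans (add_le_add hB1' hB2'))
  by_contra hcon
  simp only [Set.mem_union, Set.mem_ofPred_eq, not_or, not_exists, not_and, not_lt] at hcon
  obtain ⟨h1, h2⟩ := hcon
  have hE : ∀ v : SparseRegression.Vec p, SparseRegression.l0norm v ≤ k →
      |SparseRegression.empQ (fun i => X i ω) v - SparseRegression.qf S v| ≤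
        1 / 1000 * SparseRegression.qf S v := fun v hv => by
    have := SparseRegression.qf_nonneg hS v
    linarith [h1 v hv]
  refine hω (SparseRegression.lsLoss_guarantees hS hp hss hs hk hE
    (fun i => hM.response_eq i ω) (fun j => h2 j ?_) hθbar)
  have h3 := (abs_le.1 (hE (EuclideanSpace.single j 1)
    ((SparseRegression.l0norm_single_le j 1).trans hk0))).2
  rw [SparseRegression.qf_single] at h3
  have h4 : SparseRegression.empQ (fun i => X i ω) (EuclideanSpace.single j 1) =
      1 / (n : ℝ) * ∑ i, (X i ω j) ^ 2 := by
    simp [SparseRegression.empQ, EuclideanSpace.inner_single_right]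
  rw [h4] at h3
  linarith [hSd j]
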